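/- **Conventions.** A *bispace* is a set with two topologies $\Omega^+(X),\Omega^-(X)$; $\mathbf{BiTop}$ is the category of bispaces and bicontinuous maps, and $\Omega(X)$ is the patch topology generated by $\Omega^+(X)\cup\Omega^-(X)$. A *biframe* $\mathcal L=(L^+,L^-,L)$ consists of frames with injective frame maps $L^\pm\to L$ such that every element of $L$ is a join of elements $a^+\wedge a^-$; a morphism is a pair of frame maps $(f^+,f^-)$ that extends to a frame map of main components. Let $C_L$ be the congruence of the copairing $L^+\oplus L^-\to L$ (here $\oplus$ is the coproduct of frames). An element of $L^+\oplus L^-$ is *finitary* if it is a finite join of elements $a^+\wedge a^-$; $\mathcal L$ is *finitary* if $C_L$ is generated by a relation between finitary elements; $i:\mathbf{BiFrm_{fin}}\to\mathbf{BiFrm}$ is the inclusion of the full subcategory of finitary biframes. A *d-frame* is a quadruple $(L^+,L^-,c,t)$ with $L^\pm$ frames, $c\subseteq L^+\times L^-$ a downset closed under arbitrary homogeneous joins (joins of families constant in one coordinate), $t\subseteq L^+\times L^-$ an upset closed under finite homogeneous meets (empty families included), such that $(a,b)\in c,(a,b')\in t$ imply $b\le b'$, and $(a,b)\in c,(a',b)\in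 t$ imply $a\le a'$; morphisms are pairs of frame maps preserving $c$ and $t$. **Functors.** - $\mathsf b\Omega(X)=(\Omega^+(X),\Omega^-(X),\Omega(X))$; $\mathsf b\Omega_{\mathsf{fin}}(X)=(\Omega^+(X),\Omega^-(X),\Omega_{\mathsf{fin}}(X))$, where $\Omega_{\mathsf{fin}}(X)$ is $\Omega^+(X)\oplus\Omega^-(X)$ modulo $U^+\wedge U^-\le V^+\vee V^-$ whenever $U^+\cap U^-\subseteq V^+\cup V^-$; $\mathsf d\Omega(X)=(\Omega^+(X),\Omega^-(X),\{U^+\cap U^-=\emptyset\},\{U^+\cup U^-=X\})$. All three send $f$ to $(f^{-1},f^{-1})$. - $\mathsf{bpt}(\mathcal L)$ is the set of biframe maps $\mathcal L\to(2,2,2)$, and $\mathsf{dpt}(\mathcal L)$ the set of d-frame maps from $\mathcal L$ to $\mathbf 2=(2,2,\{a\wedge b=0\},\{a\vee b=1\})$, with positive opens $\{f:f^+(a)=1\}$, $a\in L^+$, and negative opens $\{f:f^-(b)=1\}$, $b\in L^-$; both act by precomposition. - $\mathit{fin}(\mathcal L)=(L^+,L^-,(L^+\oplus L^-)/\mathit{fin}(C_L))$,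 where $\mathit{fin}(C_L)$ is the congruence generated by the pairs of finitary elements in $C_L$. - $\Delta(\mathcal L)=(L^+,L^-,\{a\wedge b=0\text{ in }L\},\{a\vee b=1\text{ in }L\})$. - For a d-frame $\mathcal L$, $\Gamma(\mathcal L)$ has as main component $G$ the frame $L^+\oplus L^-$ modulo $a\wedge b=0$ for $(a,b)\in c$ and $a\vee b=1$ for $(a,b)\in t$; its positive and negative components are the images of $L^+$ and $L^-$ in $G$ (so they are $L^\pm$ themselves whenever the maps $L^\pm\to G$ are injective). **Theorem.** Every $\Gamma(\mathcal L)$ is a finitary biframe, and there are adjunctions $$\mathsf b\Omega\dashv\mathsf{bpt}:\mathbf{BiFrm}^{op}\to\mathbf{BiTop},\quad \mathsf b\Omega_{\mathsf{fin}}\dashv\mathsf{bpt}\circ i:\mathbf{BiFrm_{fin}}^{op}\to\mathbf{BiTop},\quad \mathsf d\Omega\dashv\mathsf{dpt}:\mathbf{dFrm}^{op}\to\mathbf{BiTop},$$ whose units send a point $x$ to the pair of its neighbourhood maps, and whose counits are the spatialization maps $a\mapsto\{f:f^\pm(a)=1\}$; a coreflection $i\dashv\mathit{fin}$ whose unit is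 an isomorphism and whose unit and counit are identities on the positive and negative components; and an adjunction between $\mathbf{BiFrm_{fin}}$ and $\mathbf{dFrm}$, namely $\Gamma\dashv\Delta$, i.e. $\Delta\dashv\Gamma$ between the opposite categories, whose unit $\mathcal L\to\Delta\Gamma\mathcal L$ consists of the canonical maps $L^\pm\to\Gamma(\mathcal L)^\pm$ (bijective if $L^\pm\to G$ is injective), and whose counit $\Gamma\Delta\mathcal L\to\mathcal L$ takes the class of $a\in L^\pm$ to $a$. Moreover: 1. $\mathsf b\Omega_{\mathsf{fin}}=\mathit{fin}\circ\mathsf b\Omega$, and under this identification $\mathsf b\Omega_{\mathsf{fin}}\dashv\mathsf{bpt}\circ i$ is the composite of $\mathsf b\Omega\dashv\mathsf{bpt}$ with the coreflection $i\dashv\mathit{fin}$ (taken in the opposite categories). 2. $\mathsf d\Omega=\Delta\circ\mathsf b\Omega=\Delta\circ\mathit{fin}\circ\mathsf b\Omega$ (the first $\Delta$ being taken on all biframes); $\mathsf{dpt}\cong\mathsf{bpt}\circ\Gamma$ by the natural bihomeomorphism that takes a bipoint $p$ of $\Gamma(\mathcal L)$ to its composite with the canonical maps $L^\pm\to\Gamma(\mathcal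 L)^\pm$; and under these identifications $\mathsf d\Omega\dashv\mathsf{dpt}$ is the composite of $\mathsf b\Omega\dashv\mathsf{bpt}$, the coreflection $i\dashv\mathit{fin}$ and the adjunction $\Delta\dashv\Gamma$. -/

import Mathlib

open CategoryTheory TopologicalSpace
open scoped Topology

universe u v w

/-! ### Frame congruences and quotients of frames -/

/-- A congruence on a frame: an equivalence relation compatible with finite meets and
arbitrary joins. -/
@[ext]
structure FrameCon (L : Type u) [Order.Frame L] extends Setoid L where
  inf' : ∀ {a b c d : L}, r a b → r c d → r (a ⊓ c) (b ⊓ d)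
  iSup' : ∀ {ι : Type u} (f g : ι → L), (∀ i, r (f i) (g i)) → r (⨆ i, f i) (⨆ i, g i)

namespace FrameCon

section
variable {L : Type u} [Order.Frame L]

/-- The congruence generated by a relation `R`, each pair `(x, y)` of which stands for the
inequality `x ≤ y`: the least congruence identifying `x ⊓ y` with `x` whenever `R x y`.
(If `R` is symmetric this is the least congruence containing `R`.) -/
def gen (R : L → L → Prop) : FrameCon L where
  r x y := ∀ θ : FrameCon L, (∀ u v, R u v → θ.r (u ⊓ v) u) → θ.r x y
  iseqv :=
    { refl := fun x θ _ => θ.iseqv.refl x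
      symm := fun h θ hθ => θ.iseqv.symm (h θ hθ)
      trans := fun h h' θ hθ => θ.iseqv.trans (h θ hθ) (h' θ hθ) }
  inf' h h' θ hθ := θ.inf' (h θ hθ) (h' θ hθ)
  iSup' f g h θ hθ := θ.iSup' f g fun i => h i θ hθ

/-- The congruence of a frame map. -/
def ker {M : Type v} [Order.Frame M] (f : FrameHom L M) : FrameCon L where
  r x y := f x = f y
  iseqv := ⟨fun _ => rfl, fun h => h.symm, fun h h' => h.trans h'⟩
  inf' h h' := by rw [map_inf, map_inf, h, h']
  iSup' f g h := by rw [map_iSup, map_iSup]; exact iSup_congr h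

theorem gen_le {R : L → L → Prop} {θ : FrameCon L} (h : ∀ u v, R u v → θ.r (u ⊓ v) u)
    {x y : L} (hxy : (gen R).r x y) : θ.r x y := hxy θ h

theorem gen_le_ker {M : Type v} [Order.Frame M] {R : L → L → Prop} {f : FrameHom L M}
    (h : ∀ u v, R u v → f u ≤ f v) {x y : L} (hxy : (gen R).r x y) : f x = f y :=
  gen_le (θ := ker f) (fun u v huv => by
    change f (u ⊓ v) = f u
    rw [map_inf, inf_eq_left]; exact h u v huv) hxy

variable (θ : FrameCon L)

theorem sup' {a b c d : L} (h : θ.r a b) (h' : θ.r c d) : θ.r (a ⊔ c) (b ⊔ d) := by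
  have := θ.iSup' (ι := ULift.{u} Bool) (fun i => cond i.down a c) (fun i => cond i.down b d)
    (by rintro ⟨_ | _⟩ <;> assumption)
  have e : ∀ p q : L, (⨆ i : ULift.{u} Bool, cond i.down p q) = p ⊔ q := fun p q => by
    apply le_antisymm
    · exact iSup_le (by rintro ⟨_ | _⟩ <;> simp)
    · exact sup_le (le_iSup (fun i : ULift.{u} Bool => cond i.down p q) ⟨true⟩)
        (le_iSup (fun i : ULift.{u} Bool => cond i.down p q) ⟨false⟩)
  rwa [e, e] at this

theorem rel_sSup (x : L) : θ.r (sSup {y | θ.r y x}) x := by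
  have h := θ.iSup' (ι := {y // θ.r y x}) (fun y => y.1) (fun _ => x) (fun y => y.2)
  have : Nonempty {y // θ.r y x} := ⟨⟨x, θ.iseqv.refl x⟩⟩
  rw [iSup_const] at h
  rwa [sSup_eq_iSup']

/-- The nucleus of a congruence, taking every element to the largest element congruent to it. -/
def nucleus : Nucleus L where
  toFun x := sSup {y | θ.r y x}
  map_inf' x y := by
    have mono : ∀ {p q : L}, p ≤ q → sSup {y | θ.r y p} ≤ sSup {y | θ.r y q} := by
      intro p q hpq
      have h := θ.sup' (θ.rel_sSup p) (θ.iseqv.refl q)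
      rw [sup_eq_right.2 hpq] at h
      exact le_sup_left.trans (le_sSup h)
    apply le_antisymm
    · exact le_inf (mono inf_le_left) (mono inf_le_right)
    · exact le_sSup (θ.inf' (θ.rel_sSup x) (θ.rel_sSup y))
  idempotent' x := sSup_le_sSup fun _ hy => θ.iseqv.trans hy (θ.rel_sSup x)
  le_apply' x := le_sSup (θ.iseqv.refl x)

theorem rel_nucleus (x : L) : θ.r (θ.nucleus x) x := θ.rel_sSup x

theorem nucleus_eq_iff {x y : L} : θ.nucleus x = θ.nucleus y ↔ θ.r x y := by
  constructor
  · intro h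
    have h1 := θ.rel_nucleus x
    rw [h] at h1
    exact θ.iseqv.trans (θ.iseqv.symm h1) (θ.rel_nucleus y)
  · intro h
    have : {z | θ.r z x} = {z | θ.r z y} := by
      ext z
      exact ⟨fun hz => θ.iseqv.trans hz h, fun hz => θ.iseqv.trans hz (θ.iseqv.symm h)⟩
    change sSup _ = sSup _
    rw [this]

/-- The quotient frame `L / θ`, with the largest element of a class as its representative. -/
def Quo : Type u := Set.range θ.nucleus

instance : Order.Frame θ.Quo := inferInstanceAs (Order.Frame (Set.range θ.nucleus))

/-- The quotient map. -/
def proj : FrameHom L θ.Quo := θ.nucleus.restrict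

theorem proj_eq_iff {x y : L} : θ.proj x = θ.proj y ↔ θ.r x y :=
  Subtype.ext_iff.trans θ.nucleus_eq_iff

theorem proj_surjective : Function.Surjective θ.proj := by
  rintro ⟨_, x, rfl⟩
  exact ⟨x, rfl⟩

variable {θ} {M : Type v} [Order.Frame M]

/-- A frame map constant on the classes of `θ` factors through `L / θ`. -/
def lift (f : FrameHom L M) (h : ∀ {x y}, θ.r x y → f x = f y) : FrameHom θ.Quo M :=
  have key : ∀ x : L, f (θ.proj x).1 = f x := fun x => h (θ.rel_nucleus x)
  { toFun := fun q => f q.1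
    map_inf' := fun p q => by
      obtain ⟨x, rfl⟩ := θ.proj_surjective p
      obtain ⟨y, rfl⟩ := θ.proj_surjective q
      rw [← map_inf, key, key, key, map_inf]
    map_top' := by rw [← map_top θ.proj, key, map_top]
    map_sSup' := fun S => by
      have hS : S = θ.proj '' (θ.proj ⁻¹' S) := (Set.image_preimage_eq S θ.proj_surjective).symm
      rw [hS, ← map_sSup, key, map_sSup, Set.image_image]
      simp only [key] }

@[simp]
theorem lift_proj (f : FrameHom L M) (h : ∀ {x y}, θ.r x y → f x = f y) (x : L) :
    lift f h (θ.proj x) = f x := h (θ.rel_nucleus x)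

theorem gen_proj_le {R : L → L → Prop} {x y : L} (h : R x y) :
    (gen R).proj x ≤ (gen R).proj y := by
  rw [← inf_eq_left, ← map_inf, proj_eq_iff]
  exact fun θ hθ => hθ x y h

end

end FrameCon

/-! ### The coproduct of two frames -/

section Coproduct

variable (A : Type u) (B : Type u) [Order.Frame A] [Order.Frame B]

/-- The defining relations of the coproduct of two frames: joins in either coordinate of a
rectangle are preserved. -/
inductive FrmCoprod.Rel : LowerSet (A × B) → LowerSet (A × B) → Prop
  | left (S : Set A) (b : B) :
      FrmCoprod.Rel (LowerSet.Iic (sSup S, b)) (⨆ a ∈ S, LowerSet.Iic (a, b))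
  | right (a : A) (S : Set B) :
      FrmCoprod.Rel (LowerSet.Iic (a, sSup S)) (⨆ b ∈ S, LowerSet.Iic (a, b))

/-- The coproduct `A ⊕ B` of two frames: down-sets of `A × B` modulo the relations above. -/
abbrev FrmCoprod : Type u := (FrameCon.gen (FrmCoprod.Rel A B)).Quo

end Coproduct

namespace FrmCoprod

variable {A : Type u} {B : Type u} [Order.Frame A] [Order.Frame B]

/-- The class of the rectangle below `(a, b)`. -/
def rect (a : A) (b : B) : FrmCoprod A B :=
  (FrameCon.gen (FrmCoprod.Rel A B)).proj (LowerSet.Iic (a, b))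

theorem rect_mono {a a' : A} {b b' : B} (h : a ≤ a') (h' : b ≤ b') :
    rect a b ≤ rect a' b' :=
  OrderHomClass.mono (FrameCon.gen (FrmCoprod.Rel A B)).proj (LowerSet.Iic_le.2 ⟨h, h'⟩)

theorem rect_inf (a a' : A) (b b' : B) :
    rect (a ⊓ a') (b ⊓ b') = rect a b ⊓ rect a' b' := by
  unfold rect
  rw [← map_inf]
  refine congrArg _ ?_
  ext x
  simp only [LowerSet.coe_inf, Set.mem_inter_iff, SetLike.mem_coe, LowerSet.mem_Iic_iff]
  exact ⟨fun h => ⟨h.trans ⟨inf_le_left, inf_le_left⟩, h.trans ⟨inf_le_right, inf_le_right⟩⟩,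
    fun h => ⟨le_inf h.1.1 h.2.1, le_inf h.1.2 h.2.2⟩⟩

theorem rect_sSup_left (S : Set A) (b : B) :
    rect (sSup S) b = ⨆ a ∈ S, rect a b := by
  apply le_antisymm
  · have := FrameCon.gen_proj_le (FrmCoprod.Rel.left S b)
    rwa [map_iSup₂] at this
  · exact iSup₂_le fun a ha => rect_mono (le_sSup ha) le_rfl

theorem rect_sSup_right (a : A) (S : Set B) :
    rect a (sSup S) = ⨆ b ∈ S, rect a b := by
  apply le_antisymm
  · have := FrameCon.gen_proj_le (FrmCoprod.Rel.right a S)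
    rwa [map_iSup₂] at this
  · exact iSup₂_le fun b hb => rect_mono le_rfl (le_sSup hb)

theorem rect_top : rect (⊤ : A) (⊤ : B) = ⊤ := by
  unfold rect
  rw [← map_top (FrameCon.gen (FrmCoprod.Rel A B)).proj]
  refine congrArg _ ?_
  ext x
  exact ⟨fun _ => trivial, fun _ => LowerSet.mem_Iic_iff.2 ⟨le_top, le_top⟩⟩

/-- The first coproduct injection. -/
def inl : FrameHom A (FrmCoprod A B) where
  toFun a := rect a ⊤
  map_inf' a a' := by rw [← rect_inf, inf_idem]
  map_top' := rect_top
  map_sSup' S := by rw [rect_sSup_left, sSup_image]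

/-- The second coproduct injection. -/
def inr : FrameHom B (FrmCoprod A B) where
  toFun b := rect ⊤ b
  map_inf' b b' := by rw [← rect_inf, inf_idem]
  map_top' := rect_top
  map_sSup' S := by rw [rect_sSup_right, sSup_image]

theorem rect_eq (a : A) (b : B) : rect a b = inl a ⊓ inr b := by
  change _ = rect a ⊤ ⊓ rect ⊤ b
  rw [← rect_inf, inf_top_eq, top_inf_eq]

theorem exists_eq_iSup (x : FrmCoprod A B) :
    ∃ (ι : Type u) (a : ι → A) (b : ι → B), x = ⨆ i, inl (a i) ⊓ inr (b i) := by
  obtain ⟨D, rfl⟩ := FrameCon.proj_surjective _ x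
  refine ⟨{p // p ∈ D}, fun p => p.1.1, fun p => p.1.2, ?_⟩
  have hD : D = ⨆ p : {p // p ∈ D}, LowerSet.Iic p.1 := by
    ext q
    simp only [SetLike.mem_coe, LowerSet.mem_iSup_iff, LowerSet.mem_Iic_iff]
    exact ⟨fun hq => ⟨⟨q, hq⟩, le_rfl⟩, fun ⟨p, hp⟩ => D.lower hp p.2⟩
  conv_lhs => rw [hD, map_iSup]
  exact iSup_congr fun p => rect_eq p.1.1 p.1.2

section
variable {M : Type v} [Order.Frame M]

theorem hom_ext {f g : FrameHom (FrmCoprod A B) M} (hl : ∀ a, f (inl a) = g (inl a))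
    (hr : ∀ b, f (inr b) = g (inr b)) : f = g := by
  ext x
  obtain ⟨ι, a, b, rfl⟩ := exists_eq_iSup x
  simp only [map_iSup, map_inf, hl, hr]

/-- The copairing on down-sets. -/
def preDesc (f : FrameHom A M) (g : FrameHom B M) : FrameHom (LowerSet (A × B)) M where
  toFun D := ⨆ p : {p // p ∈ D}, f p.1.1 ⊓ g p.1.2
  map_inf' D E := by
    apply le_antisymm
    · exact le_inf
        (iSup_le fun p => le_iSup (fun q : {q // q ∈ D} => f q.1.1 ⊓ g q.1.2) ⟨p.1, p.2.1⟩)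
        (iSup_le fun p => le_iSup (fun q : {q // q ∈ E} => f q.1.1 ⊓ g q.1.2) ⟨p.1, p.2.2⟩)
    · rw [iSup_inf_iSup]
      refine iSup_le fun pq => ?_
      refine le_trans (le_of_eq ?_) (le_iSup
        (fun q : {q // q ∈ D ⊓ E} => f q.1.1 ⊓ g q.1.2)
        ⟨pq.1.1 ⊓ pq.2.1, D.lower inf_le_left pq.1.2, E.lower inf_le_right pq.2.2⟩)
      simp only [Prod.fst_inf, Prod.snd_inf, map_inf]
      exact inf_inf_inf_comm _ _ _ _
  map_top' := by
    refine top_le_iff.1 (le_trans (le_of_eq ?_) (le_iSup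
      (fun q : {q // q ∈ (⊤ : LowerSet (A × B))} => f q.1.1 ⊓ g q.1.2) ⟨⊤, trivial⟩))
    simp
  map_sSup' S := by
    rw [sSup_image]
    apply le_antisymm
    · refine iSup_le fun ⟨p, hp⟩ => ?_
      obtain ⟨D, hD, hpD⟩ := LowerSet.mem_sSup_iff.1 hp
      exact (le_iSup (fun q : {q // q ∈ D} => f q.1.1 ⊓ g q.1.2) ⟨p, hpD⟩).trans
        (le_iSup₂ (f := fun (D : LowerSet (A × B)) (_ : D ∈ S) =>
          ⨆ q : {q // q ∈ D}, f q.1.1 ⊓ g q.1.2) D hD)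
    · exact iSup₂_le fun D hD => iSup_le fun p =>
        le_iSup (fun q : {q // q ∈ sSup S} => f q.1.1 ⊓ g q.1.2)
          ⟨p.1, LowerSet.mem_sSup_iff.2 ⟨D, hD, p.2⟩⟩

theorem preDesc_Iic (f : FrameHom A M) (g : FrameHom B M) (a : A) (b : B) :
    preDesc f g (LowerSet.Iic (a, b)) = f a ⊓ g b := by
  apply le_antisymm
  · exact iSup_le fun p =>
      inf_le_inf (OrderHomClass.mono f p.2.1) (OrderHomClass.mono g p.2.2)
  · exact le_iSup (fun q : {q // q ∈ LowerSet.Iic (a, b)} => f q.1.1 ⊓ g q.1.2)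
      ⟨(a, b), LowerSet.mem_Iic_iff.2 le_rfl⟩

theorem desc_aux (f : FrameHom A M) (g : FrameHom B M) {x y : LowerSet (A × B)}
    (h : (FrameCon.gen (Rel A B)).r x y) : preDesc f g x = preDesc f g y :=
  FrameCon.gen_le_ker (by
    rintro _ _ (⟨S, b⟩ | ⟨a, S⟩)
    · rw [preDesc_Iic, map_iSup₂, map_sSup, sSup_image, iSup₂_inf_eq]
      exact le_of_eq (iSup_congr fun a => iSup_congr fun _ => (preDesc_Iic f g a b).symm)
    · rw [preDesc_Iic, map_iSup₂, map_sSup, sSup_image, inf_iSup₂_eq]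
      exact le_of_eq (iSup_congr fun b => iSup_congr fun _ => (preDesc_Iic f g a b).symm)) h

/-- The copairing `A ⊕ B → M` of two frame maps. -/
def desc (f : FrameHom A M) (g : FrameHom B M) : FrameHom (FrmCoprod A B) M :=
  FrameCon.lift (preDesc f g) (desc_aux f g)

@[simp]
theorem desc_inl (f : FrameHom A M) (g : FrameHom B M) (a : A) : desc f g (inl a) = f a := by
  have h : desc f g (inl a) = preDesc f g (LowerSet.Iic (a, ⊤)) := FrameCon.lift_proj _ (desc_aux f g) _
  rw [h, preDesc_Iic]
  simp

@[simp]
theorem desc_inr (f : FrameHom A M) (g : FrameHom B M) (b : B) : desc f g (inr b) = g b := by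
  have h : desc f g (inr b) = preDesc f g (LowerSet.Iic (⊤, b)) := FrameCon.lift_proj _ (desc_aux f g) _
  rw [h, preDesc_Iic]
  simp

end

/-- The finitary elements of `A ⊕ B`: finite joins of elements `a ⊓ b`, with `a` in the image
of `A` and `b` in the image of `B`. -/
def IsFin (x : FrmCoprod A B) : Prop :=
  ∃ s : Finset (A × B), x = s.sup fun p => inl p.1 ⊓ inr p.2

theorem isFin_inf (a : A) (b : B) : IsFin (inl a ⊓ inr b) := ⟨{(a, b)}, by simp⟩

theorem isFin_sup (a : A) (b : B) : IsFin (inl a ⊔ inr b) := by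
  classical
  exact ⟨{(a, ⊤), (⊤, b)}, by simp⟩

end FrmCoprod

/-! ### Biframes -/

/-- A biframe: frames `L⁺`, `L⁻`, `L` with frame injections of `L⁺` and `L⁻` into the main
component `L`, every element of which is a join of elements `e⁺ a ⊓ e⁻ b`. -/
structure Biframe where
  pos : Type u
  neg : Type u
  main : Type u
  [framePos : Order.Frame pos]
  [frameNeg : Order.Frame neg]
  [frameMain : Order.Frame main]
  ePos : FrameHom pos main
  eNeg : FrameHom neg main
  ePos_injective : Function.Injective ePos
  eNeg_injective : Function.Injective eNeg
  generated : ∀ x : main, ∃ (ι : Type u) (a : ι → pos) (b : ι → neg),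
    x = ⨆ i, ePos (a i) ⊓ eNeg (b i)

attribute [instance] Biframe.framePos Biframe.frameNeg Biframe.frameMain

namespace Biframe

/-- A morphism of biframes: a pair of frame maps `(f⁺, f⁻)` for which there is a frame map
between the main components commuting with the injections. -/
@[ext]
structure Hom (L : Biframe.{u}) (M : Biframe.{v}) where
  pos : FrameHom L.pos M.pos
  neg : FrameHom L.neg M.neg
  exists_main : ∃ f : FrameHom L.main M.main,
    (∀ a, f (L.ePos a) = M.ePos (pos a)) ∧ (∀ b, f (L.eNeg b) = M.eNeg (neg b))

/-- The identity morphism. -/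
def Hom.id (L : Biframe.{u}) : Hom L L :=
  ⟨FrameHom.id _, FrameHom.id _, FrameHom.id _, fun _ => rfl, fun _ => rfl⟩

/-- Composition of morphisms, `f` first. -/
def Hom.comp {L : Biframe.{u}} {M : Biframe.{v}} {N : Biframe.{w}} (f : Hom L M) (g : Hom M N) :
    Hom L N :=
  ⟨g.pos.comp f.pos, g.neg.comp f.neg, by
    obtain ⟨p, hp, hp'⟩ := f.exists_main
    obtain ⟨q, hq, hq'⟩ := g.exists_main
    exact ⟨q.comp p, fun a => by simp [hp, hq], fun b => by simp [hp', hq']⟩⟩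

instance : Category Biframe.{u} where
  Hom := Hom
  id := Hom.id
  comp := Hom.comp

/-- The biframe `𝟐 = (2, 2, 2)`, with the frame of truth values as the two-element frame. -/
abbrev two : Biframe.{0} where
  pos := Prop
  neg := Prop
  main := Prop
  ePos := FrameHom.id Prop
  eNeg := FrameHom.id Prop
  ePos_injective := fun _ _ h => h
  eNeg_injective := fun _ _ h => h
  generated x := ⟨Unit, fun _ => x, fun _ => x, by simp⟩

/-- The congruence `C_L` on `L⁺ ⊕ L⁻` whose quotient is (canonically isomorphic to) the main
component: the congruence of the copairing of the two injections. -/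
def con (L : Biframe.{u}) : FrameCon (FrmCoprod L.pos L.neg) :=
  FrameCon.ker (FrmCoprod.desc L.ePos L.eNeg)

/-- A biframe is finitary if `C_L` is generated by a relation between finitary elements. -/
def IsFinitary : ObjectProperty Biframe.{u} := fun L =>
  ∃ R : FrmCoprod L.pos L.neg → FrmCoprod L.pos L.neg → Prop,
    (∀ x y, R x y → FrmCoprod.IsFin x ∧ FrmCoprod.IsFin y) ∧ L.con = FrameCon.gen R

section ofCon

variable {A B : Type u} [Order.Frame A] [Order.Frame B]

/-- The biframe `(A, B, (A ⊕ B)/θ)`, for a congruence `θ` for which the two syntactic maps into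
the quotient are injective. -/
abbrev ofCon (θ : FrameCon (FrmCoprod A B))
    (hl : Function.Injective (θ.proj.comp FrmCoprod.inl))
    (hr : Function.Injective (θ.proj.comp FrmCoprod.inr)) : Biframe.{u} where
  pos := A
  neg := B
  main := θ.Quo
  ePos := θ.proj.comp FrmCoprod.inl
  eNeg := θ.proj.comp FrmCoprod.inr
  ePos_injective := hl
  eNeg_injective := hr
  generated x := by
    obtain ⟨y, rfl⟩ := θ.proj_surjective x
    obtain ⟨ι, a, b, rfl⟩ := FrmCoprod.exists_eq_iSup y
    exact ⟨ι, a, b, by simp [map_iSup]⟩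

theorem ofCon_con (θ : FrameCon (FrmCoprod A B)) (hl) (hr) : (ofCon θ hl hr).con = θ := by
  have h : FrmCoprod.desc (ofCon θ hl hr).ePos (ofCon θ hl hr).eNeg = θ.proj :=
    FrmCoprod.hom_ext (fun a => FrmCoprod.desc_inl _ _ a) (fun b => FrmCoprod.desc_inr _ _ b)
  apply FrameCon.ext
  ext x y
  change FrmCoprod.desc (ofCon θ hl hr).ePos (ofCon θ hl hr).eNeg x =
    FrmCoprod.desc (ofCon θ hl hr).ePos (ofCon θ hl hr).eNeg y ↔ θ.r x y
  rw [h, FrameCon.proj_eq_iff]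

/-- If a congruence is contained in the congruence of the copairing of two injective frame
maps, then the syntactic maps into its quotient are injective. -/
theorem injective_of_le {M : Type v} [Order.Frame M] {θ : FrameCon (FrmCoprod A B)}
    {f : FrameHom A M} {g : FrameHom B M}
    (h : ∀ {x y}, θ.r x y → FrmCoprod.desc f g x = FrmCoprod.desc f g y)
    (hf : Function.Injective f) (hg : Function.Injective g) :
    Function.Injective (θ.proj.comp (FrmCoprod.inl (A := A) (B := B))) ∧
      Function.Injective (θ.proj.comp (FrmCoprod.inr (A := A) (B := B))) := by
  constructor
  · intro a a' ha
    have := h (θ.proj_eq_iff.1 ha)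
    exact hf ((FrmCoprod.desc_inl f g a).symm.trans (this.trans (FrmCoprod.desc_inl f g a')))
  · intro a a' ha
    have := h (θ.proj_eq_iff.1 ha)
    exact hg ((FrmCoprod.desc_inr f g a).symm.trans (this.trans (FrmCoprod.desc_inr f g a')))

/-- A pair of frame maps that respects generating relations is a biframe map. -/
theorem exists_main_of_gen {A' B' : Type u} [Order.Frame A'] [Order.Frame B']
    {R : FrmCoprod A B → FrmCoprod A B → Prop} {θ' : FrameCon (FrmCoprod A' B')}
    (f : FrameHom A A') (g : FrameHom B B')
    (h : ∀ x y, R x y →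
      θ'.proj (FrmCoprod.desc (FrmCoprod.inl.comp f) (FrmCoprod.inr.comp g) x) ≤
        θ'.proj (FrmCoprod.desc (FrmCoprod.inl.comp f) (FrmCoprod.inr.comp g) y)) :
    ∃ k : FrameHom (FrameCon.gen R).Quo θ'.Quo,
      (∀ a, k ((FrameCon.gen R).proj (FrmCoprod.inl a)) = θ'.proj (FrmCoprod.inl (f a))) ∧
      (∀ b, k ((FrameCon.gen R).proj (FrmCoprod.inr b)) = θ'.proj (FrmCoprod.inr (g b))) :=
  ⟨FrameCon.lift
    (θ'.proj.comp (FrmCoprod.desc (FrmCoprod.inl.comp f) (FrmCoprod.inr.comp g)))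
    (fun hxy => FrameCon.gen_le_ker (fun u v huv => h u v huv) hxy),
    fun a => by rw [FrameCon.lift_proj]; simp, fun b => by rw [FrameCon.lift_proj]; simp⟩

end ofCon

end Biframe

/-- The category of biframes. -/
abbrev BiFrm := Biframe.{u}

/-- The full subcategory of finitary biframes. -/
abbrev BiFrmFin := (Biframe.IsFinitary.{u}).FullSubcategory

/-- The inclusion `i` of finitary biframes into biframes. -/
abbrev finIncl : BiFrmFin.{u} ⥤ BiFrm.{u} := Biframe.IsFinitary.ι

/-! ### The coreflector `fin` -/

namespace Biframe

/-- The finitary part of the congruence `C_L`: its pairs of finitary elements. -/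
def finRel (L : Biframe.{u}) (x y : FrmCoprod L.pos L.neg) : Prop :=
  L.con.r x y ∧ FrmCoprod.IsFin x ∧ FrmCoprod.IsFin y

theorem desc_eq_of_finRel (L : Biframe.{u}) {x y : FrmCoprod L.pos L.neg}
    (h : (FrameCon.gen L.finRel).r x y) :
    FrmCoprod.desc L.ePos L.eNeg x = FrmCoprod.desc L.ePos L.eNeg y :=
  FrameCon.gen_le_ker (fun _ _ huv => le_of_eq huv.1) h

/-- `fin(L) = (L⁺, L⁻, (L⁺ ⊕ L⁻)/fin(C_L))`, where the finitary interior `fin(C_L)` is the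
congruence generated by the pairs of finitary elements in `C_L`. -/
abbrev fin (L : Biframe.{u}) : Biframe.{u} :=
  ofCon (FrameCon.gen L.finRel)
    (injective_of_le L.desc_eq_of_finRel L.ePos_injective L.eNeg_injective).1
    (injective_of_le L.desc_eq_of_finRel L.ePos_injective L.eNeg_injective).2

theorem fin_isFinitary (L : Biframe.{u}) : IsFinitary L.fin :=
  ⟨L.finRel, fun _ _ h => h.2, ofCon_con _ _ _⟩

theorem desc_map {L M : Biframe.{u}} (f : L ⟶ M) :
    ∃ k : FrameHom L.main M.main, ∀ x : FrmCoprod L.pos L.neg,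
      FrmCoprod.desc M.ePos M.eNeg
        (FrmCoprod.desc (FrmCoprod.inl.comp f.pos) (FrmCoprod.inr.comp f.neg) x) =
      k (FrmCoprod.desc L.ePos L.eNeg x) := by
  obtain ⟨k, h1, h2⟩ := f.exists_main
  refine ⟨k, fun x => ?_⟩
  have : (FrmCoprod.desc M.ePos M.eNeg).comp
      (FrmCoprod.desc (FrmCoprod.inl.comp f.pos) (FrmCoprod.inr.comp f.neg)) =
      k.comp (FrmCoprod.desc L.ePos L.eNeg) :=
    FrmCoprod.hom_ext (fun a => by simp [h1]) (fun b => by simp [h2])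
  exact DFunLike.congr_fun this x

theorem isFin_map {A B A' B' : Type u} [Order.Frame A] [Order.Frame B] [Order.Frame A']
    [Order.Frame B'] (f : FrameHom A A') (g : FrameHom B B') {x : FrmCoprod A B}
    (hx : FrmCoprod.IsFin x) :
    FrmCoprod.IsFin (FrmCoprod.desc (FrmCoprod.inl.comp f) (FrmCoprod.inr.comp g) x) := by
  classical
  obtain ⟨s, rfl⟩ := hx
  refine ⟨s.image fun p => (f p.1, g p.2), ?_⟩
  rw [map_finset_sup, Finset.sup_image]
  refine Finset.sup_congr rfl fun p _ => ?_
  simp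

/-- `fin` on morphisms: the same pair of frame maps. -/
def finMap {L M : Biframe.{u}} (f : L ⟶ M) : L.fin ⟶ M.fin where
  pos := f.pos
  neg := f.neg
  exists_main := exists_main_of_gen f.pos f.neg fun x y h => by
    obtain ⟨k, hk⟩ := desc_map f
    refine FrameCon.gen_proj_le ⟨?_, isFin_map _ _ h.2.1, isFin_map _ _ h.2.2⟩
    change FrmCoprod.desc M.ePos M.eNeg _ = FrmCoprod.desc M.ePos M.eNeg _
    rw [hk, hk]
    exact congrArg k h.1

end Biframe

/-- The functor `fin : BiFrm ⥤ BiFrmFin`. -/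
def finFunctor : BiFrm.{u} ⥤ BiFrmFin.{u} where
  obj L := ⟨L.fin, L.fin_isFinitary⟩
  map f := ObjectProperty.homMk (Biframe.finMap f)

/-! ### d-frames -/

/-- A d-frame. Closure under finite homogeneous meets is closure under nullary and binary
ones. -/
@[ext]
structure DFrame where
  pos : Type u
  neg : Type u
  [framePos : Order.Frame pos]
  [frameNeg : Order.Frame neg]
  con : Set (pos × neg)
  tot : Set (pos × neg)
  con_lower : IsLowerSet con
  con_sSup_left : ∀ (S : Set pos) (b : neg), (∀ a ∈ S, (a, b) ∈ con) → (sSup S, b) ∈ con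
  con_sSup_right : ∀ (a : pos) (S : Set neg), (∀ b ∈ S, (a, b) ∈ con) → (a, sSup S) ∈ con
  tot_upper : IsUpperSet tot
  tot_top_left : ∀ b : neg, (⊤, b) ∈ tot
  tot_top_right : ∀ a : pos, (a, ⊤) ∈ tot
  tot_inf_left : ∀ (a a' : pos) (b : neg), (a, b) ∈ tot → (a', b) ∈ tot → (a ⊓ a', b) ∈ tot
  tot_inf_right : ∀ (a : pos) (b b' : neg), (a, b) ∈ tot → (a, b') ∈ tot → (a, b ⊓ b') ∈ tot
  balance_neg : ∀ (a : pos) (b b' : neg), (a, b) ∈ con → (a, b') ∈ tot → b ≤ b'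
  balance_pos : ∀ (a a' : pos) (b : neg), (a, b) ∈ con → (a', b) ∈ tot → a ≤ a'

attribute [instance] DFrame.framePos DFrame.frameNeg

namespace DFrame

/-- A morphism of d-frames: a pair of frame maps preserving `con` and `tot`. -/
@[ext]
structure Hom (L : DFrame.{u}) (M : DFrame.{v}) where
  pos : FrameHom L.pos M.pos
  neg : FrameHom L.neg M.neg
  map_con : ∀ a b, (a, b) ∈ L.con → (pos a, neg b) ∈ M.con
  map_tot : ∀ a b, (a, b) ∈ L.tot → (pos a, neg b) ∈ M.tot

/-- The identity morphism. -/
def Hom.id (L : DFrame.{u}) : Hom L L :=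
  ⟨FrameHom.id _, FrameHom.id _, fun _ _ h => h, fun _ _ h => h⟩

/-- Composition of morphisms, `f` first. -/
def Hom.comp {L : DFrame.{u}} {M : DFrame.{v}} {N : DFrame.{w}} (f : Hom L M) (g : Hom M N) :
    Hom L N :=
  ⟨g.pos.comp f.pos, g.neg.comp f.neg, fun _ _ h => g.map_con _ _ (f.map_con _ _ h),
    fun _ _ h => g.map_tot _ _ (f.map_tot _ _ h)⟩

instance : Category DFrame.{u} where
  Hom := Hom
  id := Hom.id
  comp := Hom.comp

end DFrame

/-- The category of d-frames. -/
abbrev DFrm := DFrame.{u}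

/-! ### The functor `Δ` from biframes to d-frames -/

namespace Biframe

/-- `Δ(L) = (L⁺, L⁻, con, tot)`, where `(a, b) ∈ con` if `a ⊓ b = ⊥` in the main component, and
`(a, b) ∈ tot` if `a ⊔ b = ⊤` in the main component. -/
abbrev delta (L : Biframe.{u}) : DFrame.{u} where
  pos := L.pos
  neg := L.neg
  con := {p | L.ePos p.1 ⊓ L.eNeg p.2 = ⊥}
  tot := {p | L.ePos p.1 ⊔ L.eNeg p.2 = ⊤}
  con_lower p q h hp := le_bot_iff.1 (le_trans
    (inf_le_inf (OrderHomClass.mono L.ePos h.1) (OrderHomClass.mono L.eNeg h.2)) (le_of_eq hp))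
  con_sSup_left S b h := by
    change L.ePos (sSup S) ⊓ L.eNeg b = ⊥
    rw [map_sSup, sSup_image, iSup₂_inf_eq]
    exact iSup₂_eq_bot.2 h
  con_sSup_right a S h := by
    change L.ePos a ⊓ L.eNeg (sSup S) = ⊥
    rw [map_sSup, sSup_image, inf_iSup₂_eq]
    exact iSup₂_eq_bot.2 h
  tot_upper p q h hp := top_le_iff.1 (le_trans (ge_of_eq hp)
    (sup_le_sup (OrderHomClass.mono L.ePos h.1) (OrderHomClass.mono L.eNeg h.2)))
  tot_top_left b := by simp
  tot_top_right a := by simp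
  tot_inf_left a a' b h h' := by
    change L.ePos (a ⊓ a') ⊔ L.eNeg b = ⊤
    rw [map_inf, sup_inf_right, inf_eq_top_iff]
    exact ⟨h, h'⟩
  tot_inf_right a b b' h h' := by
    change L.ePos a ⊔ L.eNeg (b ⊓ b') = ⊤
    rw [map_inf, sup_inf_left, inf_eq_top_iff]
    exact ⟨h, h'⟩
  balance_neg a b b' h h' := by
    change L.ePos a ⊓ L.eNeg b = ⊥ at h
    change L.ePos a ⊔ L.eNeg b' = ⊤ at h'
    have : L.eNeg b ≤ L.eNeg b' := by
      calc L.eNeg b = (L.ePos a ⊔ L.eNeg b') ⊓ L.eNeg b := by rw [h', top_inf_eq]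
        _ = L.eNeg b' ⊓ L.eNeg b := by rw [inf_sup_right, h, bot_sup_eq]
        _ ≤ L.eNeg b' := inf_le_left
    rw [← inf_eq_left, ← map_inf] at this
    exact inf_eq_left.1 (L.eNeg_injective this)
  balance_pos a a' b h h' := by
    change L.ePos a ⊓ L.eNeg b = ⊥ at h
    change L.ePos a' ⊔ L.eNeg b = ⊤ at h'
    have : L.ePos a ≤ L.ePos a' := by
      calc L.ePos a = L.ePos a ⊓ (L.ePos a' ⊔ L.eNeg b) := by rw [h', inf_top_eq]
        _ = L.ePos a ⊓ L.ePos a' := by rw [inf_sup_left, h, sup_bot_eq]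
        _ ≤ L.ePos a' := inf_le_right
    rw [← inf_eq_left, ← map_inf] at this
    exact inf_eq_left.1 (L.ePos_injective this)

/-- `Δ` on morphisms: the same pair of frame maps. -/
def deltaMap {L M : Biframe.{u}} (f : L ⟶ M) : L.delta ⟶ M.delta where
  pos := f.pos
  neg := f.neg
  map_con a b h := by
    obtain ⟨k, h1, h2⟩ := f.exists_main
    change L.ePos a ⊓ L.eNeg b = ⊥ at h
    change M.ePos (f.pos a) ⊓ M.eNeg (f.neg b) = ⊥
    rw [← h1, ← h2, ← map_inf, h, map_bot]
  map_tot a b h := by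
    obtain ⟨k, h1, h2⟩ := f.exists_main
    change L.ePos a ⊔ L.eNeg b = ⊤ at h
    change M.ePos (f.pos a) ⊔ M.eNeg (f.neg b) = ⊤
    rw [← h1, ← h2, ← map_sup, h, map_top]

end Biframe

/-- The functor `Δ` on all biframes. -/
def DeltaAll : BiFrm.{u} ⥤ DFrm.{u} where
  obj L := L.delta
  map f := Biframe.deltaMap f

/-- The functor `Δ : BiFrmFin ⥤ DFrm`. -/
def Delta : BiFrmFin.{u} ⥤ DFrm.{u} := finIncl ⋙ DeltaAll

/-! ### The functor `Γ` from d-frames to biframes -/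

namespace DFrame

/-- The relations imposed on `L⁺ ⊕ L⁻` by a d-frame: `a ⊓ b ≤ ⊥` for `(a, b) ∈ con`, and
`⊤ ≤ a ⊔ b` for `(a, b) ∈ tot`. -/
inductive GammaRel (L : DFrame.{u}) : FrmCoprod L.pos L.neg → FrmCoprod L.pos L.neg → Prop
  | con (a : L.pos) (b : L.neg) : (a, b) ∈ L.con →
      GammaRel L (FrmCoprod.inl a ⊓ FrmCoprod.inr b) ⊥
  | tot (a : L.pos) (b : L.neg) : (a, b) ∈ L.tot →
      GammaRel L ⊤ (FrmCoprod.inl a ⊔ FrmCoprod.inr b)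

/-- The frame presented by the generators `L⁺`, `L⁻` and the relations `con`, `tot`. -/
abbrev GammaMain (L : DFrame.{u}) : Type u := (FrameCon.gen L.GammaRel).Quo

/-- The positive syntactic map. -/
def synPos (L : DFrame.{u}) : FrameHom L.pos L.GammaMain :=
  (FrameCon.gen L.GammaRel).proj.comp FrmCoprod.inl

/-- The negative syntactic map. -/
def synNeg (L : DFrame.{u}) : FrameHom L.neg L.GammaMain :=
  (FrameCon.gen L.GammaRel).proj.comp FrmCoprod.inr

theorem syn_con (L : DFrame.{u}) {a : L.pos} {b : L.neg} (h : (a, b) ∈ L.con) :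
    L.synPos a ⊓ L.synNeg b = ⊥ := by
  have := FrameCon.gen_proj_le (GammaRel.con a b h)
  rw [map_inf, map_bot, le_bot_iff] at this
  exact this

theorem syn_tot (L : DFrame.{u}) {a : L.pos} {b : L.neg} (h : (a, b) ∈ L.tot) :
    L.synPos a ⊔ L.synNeg b = ⊤ := by
  have := FrameCon.gen_proj_le (GammaRel.tot a b h)
  rw [map_sup, map_top, top_le_iff] at this
  exact this

/-- Frame maps out of `L⁺` and `L⁻` that respect `con` and `tot` extend to `GammaMain`. -/
theorem exists_gammaLift (L : DFrame.{u}) {M : Type v} [Order.Frame M] (f : FrameHom L.pos M)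
    (g : FrameHom L.neg M) (hc : ∀ a b, (a, b) ∈ L.con → f a ⊓ g b = ⊥)
    (ht : ∀ a b, (a, b) ∈ L.tot → f a ⊔ g b = ⊤) :
    ∃ k : FrameHom L.GammaMain M,
      (∀ a, k (L.synPos a) = f a) ∧ (∀ b, k (L.synNeg b) = g b) :=
  ⟨FrameCon.lift (FrmCoprod.desc f g) (fun h => FrameCon.gen_le_ker (by
      rintro _ _ (⟨a, b, h⟩ | ⟨a, b, h⟩)
      · rw [map_inf, FrmCoprod.desc_inl, FrmCoprod.desc_inr, hc a b h]; exact bot_le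
      · rw [map_sup, FrmCoprod.desc_inl, FrmCoprod.desc_inr, ht a b h]; exact le_top) h),
    fun a => (FrameCon.lift_proj _ _ _).trans (FrmCoprod.desc_inl f g a),
    fun b => (FrameCon.lift_proj _ _ _).trans (FrmCoprod.desc_inr f g b)⟩

/-- The map induced on the image of `L⁺` by the positive syntactic map. -/
def imgPos (L : DFrame.{u}) : FrameHom (FrameCon.ker L.synPos).Quo L.GammaMain :=
  FrameCon.lift L.synPos (fun {_ _} h => h)

/-- The map induced on the image of `L⁻` by the negative syntactic map. -/
def imgNeg (L : DFrame.{u}) : FrameHom (FrameCon.ker L.synNeg).Quo L.GammaMain :=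
  FrameCon.lift L.synNeg (fun {_ _} h => h)

@[simp]
theorem imgPos_proj (L : DFrame.{u}) (a : L.pos) :
    L.imgPos ((FrameCon.ker L.synPos).proj a) = L.synPos a :=
  FrameCon.lift_proj (θ := FrameCon.ker L.synPos) L.synPos (fun {_ _} h => h) a

@[simp]
theorem imgNeg_proj (L : DFrame.{u}) (a : L.neg) :
    L.imgNeg ((FrameCon.ker L.synNeg).proj a) = L.synNeg a :=
  FrameCon.lift_proj (θ := FrameCon.ker L.synNeg) L.synNeg (fun {_ _} h => h) a

/-- The biframe `Γ(L)`. Its main component is `L⁺ ⊕ L⁻` modulo the relations `con` and `tot`;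
its positive and negative components are the images there of `L⁺` and `L⁻`, written as the
quotients of `L⁺` and `L⁻` by the congruences of the syntactic maps. (When the syntactic maps are
injective these congruences are equality, and the components are just `L⁺` and `L⁻`.) -/
abbrev gamma (L : DFrame.{u}) : Biframe.{u} where
  pos := (FrameCon.ker L.synPos).Quo
  neg := (FrameCon.ker L.synNeg).Quo
  main := L.GammaMain
  ePos := L.imgPos
  eNeg := L.imgNeg
  ePos_injective p q h := by
    obtain ⟨x, rfl⟩ := FrameCon.proj_surjective _ p
    obtain ⟨y, rfl⟩ := FrameCon.proj_surjective _ q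
    rw [imgPos_proj, imgPos_proj] at h
    exact (FrameCon.proj_eq_iff _).2 h
  eNeg_injective p q h := by
    obtain ⟨x, rfl⟩ := FrameCon.proj_surjective _ p
    obtain ⟨y, rfl⟩ := FrameCon.proj_surjective _ q
    rw [imgNeg_proj, imgNeg_proj] at h
    exact (FrameCon.proj_eq_iff _).2 h
  generated x := by
    obtain ⟨y, rfl⟩ := FrameCon.proj_surjective _ x
    obtain ⟨ι, a, b, rfl⟩ := FrmCoprod.exists_eq_iSup y
    refine ⟨ι, fun i => (FrameCon.ker L.synPos).proj (a i), fun i => (FrameCon.ker L.synNeg).proj (b i), ?_⟩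
    simp only [imgPos_proj, imgNeg_proj, map_iSup, map_inf]
    rfl

/-- The quotient map `L⁺ → Γ(L)⁺`. -/
def toGammaPos (L : DFrame.{u}) : FrameHom L.pos L.gamma.pos := (FrameCon.ker L.synPos).proj

/-- The quotient map `L⁻ → Γ(L)⁻`. -/
def toGammaNeg (L : DFrame.{u}) : FrameHom L.neg L.gamma.neg := (FrameCon.ker L.synNeg).proj

theorem gamma_ePos (L : DFrame.{u}) (a : L.pos) :
    L.gamma.ePos (L.toGammaPos a) = L.synPos a := L.imgPos_proj a

theorem gamma_eNeg (L : DFrame.{u}) (b : L.neg) :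
    L.gamma.eNeg (L.toGammaNeg b) = L.synNeg b := L.imgNeg_proj b

theorem gamma_isFinitary (L : DFrame.{u}) : Biframe.IsFinitary L.gamma := by
  let R : FrmCoprod L.gamma.pos L.gamma.neg → FrmCoprod L.gamma.pos L.gamma.neg → Prop :=
    fun x y => L.gamma.con.r (x ⊓ y) x ∧ FrmCoprod.IsFin x ∧ FrmCoprod.IsFin y
  refine ⟨R, fun x y h => h.2, ?_⟩
  obtain ⟨k, hk, hk'⟩ := L.exists_gammaLift
    (((FrameCon.gen R).proj.comp FrmCoprod.inl).comp L.toGammaPos)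
    (((FrameCon.gen R).proj.comp FrmCoprod.inr).comp L.toGammaNeg)
    (fun a b h => by
      have hR : R (FrmCoprod.inl (L.toGammaPos a) ⊓ FrmCoprod.inr (L.toGammaNeg b)) ⊥ := by
        refine ⟨?_, FrmCoprod.isFin_inf _ _, ⟨∅, rfl⟩⟩
        change FrmCoprod.desc L.gamma.ePos L.gamma.eNeg _ =
          FrmCoprod.desc L.gamma.ePos L.gamma.eNeg _
        rw [inf_bot_eq, map_bot, map_inf, FrmCoprod.desc_inl, FrmCoprod.desc_inr, gamma_ePos,
          gamma_eNeg, L.syn_con h]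
      have := FrameCon.gen_proj_le hR
      rw [map_inf, map_bot, le_bot_iff] at this
      exact this)
    (fun a b h => by
      have hR : R ⊤ (FrmCoprod.inl (L.toGammaPos a) ⊔ FrmCoprod.inr (L.toGammaNeg b)) := by
        refine ⟨?_, ⟨{⊤}, by simp⟩, FrmCoprod.isFin_sup _ _⟩
        change FrmCoprod.desc L.gamma.ePos L.gamma.eNeg _ =
          FrmCoprod.desc L.gamma.ePos L.gamma.eNeg _
        rw [top_inf_eq, map_top, map_sup, FrmCoprod.desc_inl, FrmCoprod.desc_inr, gamma_ePos,
          gamma_eNeg, L.syn_tot h]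
      have := FrameCon.gen_proj_le hR
      rw [map_sup, map_top, top_le_iff] at this
      exact this)
  have key : k.comp (FrmCoprod.desc L.gamma.ePos L.gamma.eNeg) = (FrameCon.gen R).proj := by
    refine FrmCoprod.hom_ext (fun p => ?_) (fun q => ?_)
    · obtain ⟨a, rfl⟩ := FrameCon.proj_surjective _ p
      rw [FrameHom.comp_apply, FrmCoprod.desc_inl]
      exact (congrArg k (L.gamma_ePos a)).trans (hk a)
    · obtain ⟨b, rfl⟩ := FrameCon.proj_surjective _ q
      rw [FrameHom.comp_apply, FrmCoprod.desc_inr]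
      exact (congrArg k (L.gamma_eNeg b)).trans (hk' b)
  apply FrameCon.ext
  ext x y
  constructor
  · intro h
    rw [← FrameCon.proj_eq_iff, ← key]
    exact congrArg k h
  · exact fun h => FrameCon.gen_le (θ := L.gamma.con) (fun _ _ huv => huv.1) h

/-- A d-frame map induces a frame map between the presented frames. -/
theorem exists_gammaMain_map {L M : DFrame.{u}} (f : L ⟶ M) :
    ∃ k : FrameHom L.GammaMain M.GammaMain,
      (∀ a, k (L.synPos a) = M.synPos (f.pos a)) ∧
        (∀ b, k (L.synNeg b) = M.synNeg (f.neg b)) :=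
  L.exists_gammaLift (M.synPos.comp f.pos) (M.synNeg.comp f.neg)
    (fun a b h => M.syn_con (f.map_con a b h)) (fun a b h => M.syn_tot (f.map_tot a b h))

theorem gammaMap_aux_pos {L M : DFrame.{u}} (f : L ⟶ M) {x y : L.pos}
    (h : (FrameCon.ker L.synPos).r x y) :
    M.toGammaPos.comp f.pos x = M.toGammaPos.comp f.pos y := by
  obtain ⟨k, hk, -⟩ := exists_gammaMain_map f
  refine (FrameCon.proj_eq_iff _).2 ?_
  change M.synPos (f.pos x) = M.synPos (f.pos y)
  rw [← hk, ← hk]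
  exact congrArg k h

theorem gammaMap_aux_neg {L M : DFrame.{u}} (f : L ⟶ M) {x y : L.neg}
    (h : (FrameCon.ker L.synNeg).r x y) :
    M.toGammaNeg.comp f.neg x = M.toGammaNeg.comp f.neg y := by
  obtain ⟨k, -, hk⟩ := exists_gammaMain_map f
  refine (FrameCon.proj_eq_iff _).2 ?_
  change M.synNeg (f.neg x) = M.synNeg (f.neg y)
  rw [← hk, ← hk]
  exact congrArg k h

/-- `Γ` on morphisms: the pair of frame maps induced by `(f⁺, f⁻)`. -/
def gammaMap {L M : DFrame.{u}} (f : L ⟶ M) : L.gamma ⟶ M.gamma where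
  pos := FrameCon.lift (M.toGammaPos.comp f.pos) (gammaMap_aux_pos f)
  neg := FrameCon.lift (M.toGammaNeg.comp f.neg) (gammaMap_aux_neg f)
  exists_main := by
    obtain ⟨k, hk, hk'⟩ := exists_gammaMain_map f
    refine ⟨k, fun p => ?_, fun q => ?_⟩
    · obtain ⟨a, rfl⟩ := FrameCon.proj_surjective _ p
      rw [FrameCon.lift_proj]
      exact (congrArg k (L.gamma_ePos a)).trans ((hk a).trans (M.gamma_ePos (f.pos a)).symm)
    · obtain ⟨b, rfl⟩ := FrameCon.proj_surjective _ q
      rw [FrameCon.lift_proj]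
      exact (congrArg k (L.gamma_eNeg b)).trans ((hk' b).trans (M.gamma_eNeg (f.neg b)).symm)

theorem gammaMap_pos {L M : DFrame.{u}} (f : L ⟶ M) (a : L.pos) :
    (gammaMap f).pos (L.toGammaPos a) = M.toGammaPos (f.pos a) :=
  FrameCon.lift_proj (θ := FrameCon.ker L.synPos) _ (gammaMap_aux_pos f) a

theorem gammaMap_neg {L M : DFrame.{u}} (f : L ⟶ M) (b : L.neg) :
    (gammaMap f).neg (L.toGammaNeg b) = M.toGammaNeg (f.neg b) :=
  FrameCon.lift_proj (θ := FrameCon.ker L.synNeg) _ (gammaMap_aux_neg f) b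

/-- A biframe map out of `Γ(L)` is determined by its composites with the quotient maps. -/
theorem gamma_hom_ext {L : DFrame.{u}} {M : Biframe.{v}} {f g : Biframe.Hom L.gamma M}
    (hp : ∀ a, f.pos (L.toGammaPos a) = g.pos (L.toGammaPos a))
    (hn : ∀ b, f.neg (L.toGammaNeg b) = g.neg (L.toGammaNeg b)) : f = g := by
  apply Biframe.Hom.ext
  · ext p
    obtain ⟨a, rfl⟩ := FrameCon.proj_surjective _ p
    exact hp a
  · ext q
    obtain ⟨b, rfl⟩ := FrameCon.proj_surjective _ q
    exact hn b

end DFrame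

/-- The functor `Γ : DFrm ⥤ BiFrmFin`. -/
def Gamma : DFrm.{u} ⥤ BiFrmFin.{u} where
  obj L := ⟨L.gamma, L.gamma_isFinitary⟩
  map f := ObjectProperty.homMk (DFrame.gammaMap f)
  map_id L := ObjectProperty.hom_ext _ (DFrame.gamma_hom_ext
    (fun a => DFrame.gammaMap_pos (𝟙 L) a) (fun b => DFrame.gammaMap_neg (𝟙 L) b))
  map_comp f g := ObjectProperty.hom_ext _ (DFrame.gamma_hom_ext
    (fun a => (DFrame.gammaMap_pos (f ≫ g) a).trans (Eq.symm
      ((congrArg (DFrame.gammaMap g).pos (DFrame.gammaMap_pos f a)).trans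
        (DFrame.gammaMap_pos g (f.pos a)))))
    (fun b => (DFrame.gammaMap_neg (f ≫ g) b).trans (Eq.symm
      ((congrArg (DFrame.gammaMap g).neg (DFrame.gammaMap_neg f b)).trans
        (DFrame.gammaMap_neg g (f.neg b))))))

/-! ### Bispaces -/

/-- A bispace: a set with two topologies. -/
structure BiTop where
  carrier : Type u
  pos : TopologicalSpace carrier
  neg : TopologicalSpace carrier

namespace BiTop

/-- The points of a bispace, with the positive topology. -/
def P (X : BiTop.{u}) : Type u := X.carrier

/-- The points of a bispace, with the negative topology. -/
def N (X : BiTop.{u}) : Type u := X.carrier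

/-- The points of a bispace, with the patch topology: the topology generated by the positive
and the negative opens (this is `⊓` in Mathlib's order on topologies). -/
def Patch (X : BiTop.{u}) : Type u := X.carrier

instance (X : BiTop.{u}) : TopologicalSpace X.P := X.pos
instance (X : BiTop.{u}) : TopologicalSpace X.N := X.neg
instance (X : BiTop.{u}) : TopologicalSpace X.Patch := X.pos ⊓ X.neg

/-- A bicontinuous map. -/
@[ext]
structure Hom (X Y : BiTop.{u}) where
  toFun : X.carrier → Y.carrier
  continuous_pos : Continuous[X.pos, Y.pos] toFun
  continuous_neg : Continuous[X.neg, Y.neg] toFun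

instance : Category BiTop.{u} where
  Hom := Hom
  id X := ⟨id, @continuous_id _ X.pos, @continuous_id _ X.neg⟩
  comp {X Y Z} f g := ⟨g.toFun ∘ f.toFun,
    @Continuous.comp _ _ _ X.pos Y.pos Z.pos _ _ g.continuous_pos f.continuous_pos,
    @Continuous.comp _ _ _ X.neg Y.neg Z.neg _ _ g.continuous_neg f.continuous_neg⟩

/-- The identity, as a continuous map from the patch topology to the positive topology. -/
def patchP (X : BiTop.{u}) : C(X.Patch, X.P) :=
  ⟨fun x => x, continuous_id_iff_le.2 (inf_le_left : X.pos ⊓ X.neg ≤ X.pos)⟩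

/-- The identity, as a continuous map from the patch topology to the negative topology. -/
def patchN (X : BiTop.{u}) : C(X.Patch, X.N) :=
  ⟨fun x => x, continuous_id_iff_le.2 (inf_le_right : X.pos ⊓ X.neg ≤ X.neg)⟩

/-- A bicontinuous map as a continuous map for the positive topologies. -/
def Hom.P {X Y : BiTop.{u}} (f : X ⟶ Y) : C(X.P, Y.P) := ⟨f.toFun, f.continuous_pos⟩

/-- A bicontinuous map as a continuous map for the negative topologies. -/
def Hom.N {X Y : BiTop.{u}} (f : X ⟶ Y) : C(X.N, Y.N) := ⟨f.toFun, f.continuous_neg⟩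

/-- A bicontinuous map as a continuous map for the patch topologies. -/
def Hom.patch {X Y : BiTop.{u}} (f : X ⟶ Y) : C(X.Patch, Y.Patch) :=
  ⟨f.toFun, continuous_inf_rng.2
    ⟨continuous_inf_dom_left f.continuous_pos, continuous_inf_dom_right f.continuous_neg⟩⟩

/-- A positive open as a set of points. -/
def posSet {X : BiTop.{u}} (U : Opens X.P) : Set X.carrier := U.1

/-- A negative open as a set of points. -/
def negSet {X : BiTop.{u}} (U : Opens X.N) : Set X.carrier := U.1

/-! ### The biframe, the finitary biframe and the d-frame of opens -/

/-- The biframe of opens `(Ω⁺(X), Ω⁻(X), Ω(X))`, with `Ω(X)` the frame of patch-opens. -/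
abbrev bOmegaObj (X : BiTop.{u}) : Biframe.{u} where
  pos := Opens X.P
  neg := Opens X.N
  main := Opens X.Patch
  ePos := Opens.comap X.patchP
  eNeg := Opens.comap X.patchN
  ePos_injective U V h := Opens.ext (congrArg (fun W : Opens X.Patch => (W : Set X.Patch)) h)
  eNeg_injective U V h := Opens.ext (congrArg (fun W : Opens X.Patch => (W : Set X.Patch)) h)
  generated W := by
    refine ⟨{p : Opens X.P × Opens X.N //
      Opens.comap X.patchP p.1 ⊓ Opens.comap X.patchN p.2 ≤ W},
      fun p => p.1.1, fun p => p.1.2, le_antisymm ?_ (iSup_le fun p => p.2)⟩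
    intro x hx
    have hW : W.1 ∈ @nhds X.carrier X.pos x ⊓ @nhds X.carrier X.neg x := by
      rw [← @nhds_inf X.carrier X.pos X.neg x]
      exact W.2.mem_nhds hx
    obtain ⟨s, hs, t, ht, hst⟩ := Filter.mem_inf_iff_superset.1 hW
    obtain ⟨U, hUs, hU, hxU⟩ := (mem_nhds_iff (X := X.P)).1 hs
    obtain ⟨V, hVt, hV, hxV⟩ := (mem_nhds_iff (X := X.N)).1 ht
    exact Opens.mem_iSup.2 ⟨⟨(⟨U, hU⟩, ⟨V, hV⟩),
      fun y hy => hst ⟨hUs hy.1, hVt hy.2⟩⟩, ⟨hxU, hxV⟩⟩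

/-- The relation defining the finitary frame of opens: the pairs `(U⁺ ⊓ U⁻, V⁺ ⊔ V⁻)` for which
`U⁺ ∩ U⁻ ⊆ V⁺ ∪ V⁻`. -/
inductive FinRel (X : BiTop.{u}) :
    FrmCoprod (Opens X.P) (Opens X.N) → FrmCoprod (Opens X.P) (Opens X.N) → Prop
  | mk (U V : Opens X.P) (U' V' : Opens X.N) :
      posSet U ∩ negSet U' ⊆ posSet V ∪ negSet V' →
      FinRel X (FrmCoprod.inl U ⊓ FrmCoprod.inr U') (FrmCoprod.inl V ⊔ FrmCoprod.inr V')

theorem desc_eq_of_finRel (X : BiTop.{u}) {x y : FrmCoprod (Opens X.P) (Opens X.N)}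
    (h : (FrameCon.gen X.FinRel).r x y) :
    FrmCoprod.desc (Opens.comap X.patchP) (Opens.comap X.patchN) x =
      FrmCoprod.desc (Opens.comap X.patchP) (Opens.comap X.patchN) y :=
  FrameCon.gen_le_ker (by
    rintro _ _ ⟨U, V, U', V', h⟩
    rw [map_inf, map_sup]
    simp only [FrmCoprod.desc_inl, FrmCoprod.desc_inr]
    exact h) h

/-- The finitary biframe of opens `(Ω⁺(X), Ω⁻(X), Ω_fin(X))`. -/
abbrev bOmegaFinObj (X : BiTop.{u}) : Biframe.{u} :=
  Biframe.ofCon (FrameCon.gen X.FinRel)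
    (Biframe.injective_of_le X.desc_eq_of_finRel X.bOmegaObj.ePos_injective
      X.bOmegaObj.eNeg_injective).1
    (Biframe.injective_of_le X.desc_eq_of_finRel X.bOmegaObj.ePos_injective
      X.bOmegaObj.eNeg_injective).2

theorem bOmegaFinObj_isFinitary (X : BiTop.{u}) : Biframe.IsFinitary X.bOmegaFinObj :=
  ⟨X.FinRel, by
    rintro _ _ ⟨U, V, U', V', -⟩
    exact ⟨FrmCoprod.isFin_inf _ _, FrmCoprod.isFin_sup _ _⟩, Biframe.ofCon_con _ _ _⟩

/-- The d-frame of opens: `con` consists of the disjoint pairs, and `tot` of the covering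
pairs. -/
abbrev dOmegaObj (X : BiTop.{u}) : DFrame.{u} where
  pos := Opens X.P
  neg := Opens X.N
  con := {p | posSet p.1 ∩ negSet p.2 = ∅}
  tot := {p | posSet p.1 ∪ negSet p.2 = Set.univ}
  con_lower p q h hp :=
    Set.subset_eq_empty (Set.inter_subset_inter h.1 h.2) hp
  con_sSup_left S b h := by
    apply Set.eq_empty_iff_forall_notMem.2
    rintro x ⟨hx, hx'⟩
    obtain ⟨U, hU, hxU⟩ := (Opens.mem_sSup (α := X.P)).1 hx
    exact Set.eq_empty_iff_forall_notMem.1 (h U hU) x ⟨hxU, hx'⟩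
  con_sSup_right a S h := by
    apply Set.eq_empty_iff_forall_notMem.2
    rintro x ⟨hx, hx'⟩
    obtain ⟨U, hU, hxU⟩ := (Opens.mem_sSup (α := X.N)).1 hx'
    exact Set.eq_empty_iff_forall_notMem.1 (h U hU) x ⟨hx, hxU⟩
  tot_upper p q h hp :=
    Set.univ_subset_iff.1 ((ge_of_eq hp : Set.univ ⊆ _).trans (Set.union_subset_union h.1 h.2))
  tot_top_left b := Set.univ_union _
  tot_top_right a := Set.union_univ _
  tot_inf_left a a' b h h' := Set.eq_univ_of_forall fun x =>
    (Set.eq_univ_iff_forall.1 h x).elim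
      (fun hx => (Set.eq_univ_iff_forall.1 h' x).elim (fun hx' => Or.inl ⟨hx, hx'⟩) Or.inr) Or.inr
  tot_inf_right a b b' h h' := Set.eq_univ_of_forall fun x =>
    (Set.eq_univ_iff_forall.1 h x).elim Or.inl
      fun hx => (Set.eq_univ_iff_forall.1 h' x).elim Or.inl fun hx' => Or.inr ⟨hx, hx'⟩
  balance_neg a b b' h h' := fun (x : X.carrier) (hx : x ∈ negSet b) =>
    (Set.eq_univ_iff_forall.1 h' x).elim
      (fun ha => absurd ⟨ha, hx⟩ (Set.eq_empty_iff_forall_notMem.1 h x)) id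
  balance_pos a a' b h h' := fun (x : X.carrier) (hx : x ∈ posSet a) =>
    (Set.eq_univ_iff_forall.1 h' x).elim id
      (fun hb => absurd ⟨hx, hb⟩ (Set.eq_empty_iff_forall_notMem.1 h x))

end BiTop

/-- The functor `bΩ`, sending a bicontinuous map to the pair of its preimage maps. -/
def bOmega : BiTop.{u} ⥤ BiFrm.{u}ᵒᵖ where
  obj X := Opposite.op X.bOmegaObj
  map f := Quiver.Hom.op (show Biframe.Hom _ _ from
    ⟨Opens.comap (BiTop.Hom.P f), Opens.comap (BiTop.Hom.N f), Opens.comap (BiTop.Hom.patch f),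
      fun _ => rfl, fun _ => rfl⟩)

/-- The functor `bΩ_fin`, sending a bicontinuous map to the pair of its preimage maps. -/
def bOmegaFin : BiTop.{u} ⥤ BiFrmFin.{u}ᵒᵖ where
  obj X := Opposite.op ⟨X.bOmegaFinObj, X.bOmegaFinObj_isFinitary⟩
  map f := Quiver.Hom.op (ObjectProperty.homMk (show Biframe.Hom _ _ from
    ⟨Opens.comap (BiTop.Hom.P f), Opens.comap (BiTop.Hom.N f),
      Biframe.exists_main_of_gen _ _ (by
        rintro _ _ ⟨U, V, U', V', h⟩
        simp only [map_inf, map_sup, FrmCoprod.desc_inl, FrmCoprod.desc_inr,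
          FrameHom.comp_apply]
        have := FrameCon.gen_proj_le (BiTop.FinRel.mk (Opens.comap (BiTop.Hom.P f) U)
          (Opens.comap (BiTop.Hom.P f) V) (Opens.comap (BiTop.Hom.N f) U')
          (Opens.comap (BiTop.Hom.N f) V') (fun x hx => h hx))
        simpa only [map_inf, map_sup] using this)⟩))

/-- The functor `dΩ`, sending a bicontinuous map to the pair of its preimage maps. -/
def dOmega : BiTop.{u} ⥤ DFrm.{u}ᵒᵖ where
  obj X := Opposite.op X.dOmegaObj
  map {X Y} f := Quiver.Hom.op (show DFrame.Hom _ _ from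
    ⟨Opens.comap (BiTop.Hom.P f), Opens.comap (BiTop.Hom.N f),
      fun _ _ h => Set.eq_empty_iff_forall_notMem.2 fun x hx =>
        Set.eq_empty_iff_forall_notMem.1 h (f.toFun x) hx,
      fun _ _ h => Set.eq_univ_of_forall fun x => Set.eq_univ_iff_forall.1 h (f.toFun x)⟩)

/-! ### Spectra -/

/-- The topology whose opens are the sets `{p | p ⊨ a}`, for `a` in a frame `A`, where
`p ⊨ a` means that the point `p`, a frame map into the two-element frame, takes `a` to `1`. -/
@[reducible]
def spectralTopology {T : Type u} {A : Type v} [Order.Frame A] (ev : T → FrameHom A Prop) :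
    TopologicalSpace T where
  IsOpen S := ∃ a : A, S = {p | ev p a}
  isOpen_univ := ⟨⊤, by ext p; simp⟩
  isOpen_inter := by
    rintro _ _ ⟨a, rfl⟩ ⟨b, rfl⟩
    exact ⟨a ⊓ b, by ext p; simp⟩
  isOpen_sUnion S hS := by
    refine ⟨sSup {a | {p | ev p a} ∈ S}, ?_⟩
    ext p
    rw [Set.mem_ofPred_eq, map_sSup, sSup_image, iSup_Prop_eq]
    simp only [iSup_Prop_eq, Set.mem_sUnion, Set.mem_ofPred_eq]
    constructor
    · rintro ⟨s, hs, hp⟩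
      obtain ⟨a, rfl⟩ := hS s hs
      exact ⟨a, hs, hp⟩
    · rintro ⟨a, ha, hp⟩
      exact ⟨_, ha, hp⟩

theorem continuous_spectralTopology {T T' : Type u} {A A' : Type v} [Order.Frame A]
    [Order.Frame A'] {ev : T → FrameHom A Prop} {ev' : T' → FrameHom A' Prop} (f : T → T')
    (φ : FrameHom A' A) (h : ∀ p a, ev' (f p) a = ev p (φ a)) :
    Continuous[spectralTopology ev, spectralTopology ev'] f :=
  @Continuous.mk _ _ (spectralTopology ev) (spectralTopology ev') f (by
    rintro _ ⟨a, rfl⟩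
    exact ⟨φ a, by ext p; simp only [Set.mem_preimage, Set.mem_ofPred_eq, h]⟩)

/-- The bispectrum of a biframe: the set of biframe maps `L → 𝟐`, with the positive opens
`{f | f⁺ a = 1}` for `a ∈ L⁺`, and the negative opens `{f | f⁻ b = 1}` for `b ∈ L⁻`. -/
abbrev Biframe.bptObj (L : Biframe.{u}) : BiTop.{u} where
  carrier := Biframe.Hom L Biframe.two
  pos := spectralTopology (A := L.pos) fun f => f.pos
  neg := spectralTopology (A := L.neg) fun f => f.neg

/-- The functor `bpt`, acting on morphisms by precomposition. -/
def bpt : BiFrm.{u}ᵒᵖ ⥤ BiTop.{u} where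
  obj L := L.unop.bptObj
  map {L M} f :=
    { toFun := fun p => Biframe.Hom.comp f.unop p
      continuous_pos := continuous_spectralTopology _ f.unop.pos fun _ _ => rfl
      continuous_neg := continuous_spectralTopology _ f.unop.neg fun _ _ => rfl }

/-- The functor `bpt` restricted to finitary biframes. -/
abbrev bptFin : BiFrmFin.{u}ᵒᵖ ⥤ BiTop.{u} := finIncl.op ⋙ bpt

/-- The d-frame `𝟐`, with `(a, b) ∈ con` if `a = 0` or `b = 0`, and `(a, b) ∈ tot` if `a = 1` or
`b = 1`. -/
abbrev DFrame.two : DFrame.{0} := Biframe.two.delta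

/-- The spectrum of a d-frame: the set of d-frame maps `L → 𝟐`, with the positive opens
`{f | f⁺ a = 1}` for `a ∈ L⁺`, and the negative opens `{f | f⁻ b = 1}` for `b ∈ L⁻`. -/
abbrev DFrame.dptObj (L : DFrame.{u}) : BiTop.{u} where
  carrier := DFrame.Hom L DFrame.two
  pos := spectralTopology (A := L.pos) fun f => f.pos
  neg := spectralTopology (A := L.neg) fun f => f.neg

/-- The functor `dpt`, acting on morphisms by precomposition. -/
def dpt : DFrm.{u}ᵒᵖ ⥤ BiTop.{u} where
  obj L := L.unop.dptObj
  map {L M} f :=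
    { toFun := fun p => DFrame.Hom.comp f.unop p
      continuous_pos := continuous_spectralTopology _ f.unop.pos fun _ _ => rfl
      continuous_neg := continuous_spectralTopology _ f.unop.neg fun _ _ => rfl }

/-! A morphism of biframes or of d-frames is a pair of frame maps between the outer components,
subject to a condition: an extension to the main components, or preservation of `con` and `tot`. All
the units and counits are therefore explicit pairs, and naturality and the triangle identities are
equations between outer components. The work lies in the conditions, and in comparing the three
constructions of opens.

Extensions: the main component of `L` is the quotient of `L⁺ ⊕ L⁻` by `C_L`, so a pair extends as
soon as its copairing respects `C_L` (`exists_main_of_con`). For spatialization this can be tested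
at each bipoint, which has an extension of its own to the main component.

Finitary parts: by distributivity a finitary element is a finite join of elements `a ⊓ b` and also a
finite meet of elements `a ⊔ b`. An inequality between finitary elements thus amounts to finitely
many inequalities `a ⊓ b ≤ a' ⊔ b'`, which are the relations defining `Ω_fin`; hence `Ω_fin` comes
from the finitary part of the congruence of the patch frame (`BiTop.gen_finRel_eq`). For finitary
`L` the congruences `C_L` and `fin(C_L)` agree (`IsFinitary.con_eq`), which gives the coreflection.
As `a ⊓ b = ⊥` and `a ⊔ b = ⊤` are equations between finitary elements, `Δ` does not distinguish `L`
from `fin(L)`.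

`Γ ⊣ Δ` is the universal property of a frame presented by `con` and `tot`; injectivity of `M⁺, M⁻ →
M` lets the maps descend to the images of `L⁺, L⁻` (`exists_gammaDesc`). Since the d-frame `𝟐` is
`Δ(2, 2, 2)`, the same property matches d-points of `L` with bipoints of `Γ(L)`.

The adjunctions for `bΩ_fin` and `dΩ` are defined as composites, transported along equalities of
functors. These transports act as the identity on opens, so the units are again the neighbourhood
maps; the counits then follow from a triangle identity. -/

/-! ### Extending pairs of frame maps to main components -/

theorem FrameHom.exists_factor {A : Type u} {B : Type v} {C : Type w} [Order.Frame A]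
    [Order.Frame B] [Order.Frame C] (π : FrameHom A B) (hπ : Function.Surjective π)
    (φ : FrameHom A C) (h : ∀ x y, π x = π y → φ x = φ y) :
    ∃ k : FrameHom B C, ∀ x, k (π x) = φ x := by
  -- A section of `π` defines `k`; from here on only `hk` is used, since every element and every
  -- subset of `B` comes from `A`.
  obtain ⟨k, hk⟩ : ∃ k : B → C, ∀ x, k (π x) = φ x :=
    ⟨fun b => φ (Function.surjInv hπ b), fun x => h _ _ (Function.surjInv_eq hπ (π x))⟩
  refine ⟨⟨⟨⟨k, fun a b => ?_⟩, ?_⟩, fun S => ?_⟩, hk⟩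
  · obtain ⟨x, rfl⟩ := hπ a
    obtain ⟨y, rfl⟩ := hπ b
    rw [← map_inf, hk, hk, hk, map_inf]
  · change k ⊤ = ⊤
    rw [← map_top π, hk, map_top]
  · change k (sSup S) = sSup (k '' S)
    have hS : S = π '' (π ⁻¹' S) := (Set.image_preimage_eq S hπ).symm
    rw [hS, ← map_sSup, hk, map_sSup, Set.image_image]
    simp only [hk]

namespace Biframe

theorem desc_surjective (L : Biframe.{u}) :
    Function.Surjective (FrmCoprod.desc L.ePos L.eNeg) := by
  intro m
  obtain ⟨ι, a, b, rfl⟩ := L.generated m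
  exact ⟨⨆ i, FrmCoprod.inl (a i) ⊓ FrmCoprod.inr (b i), by simp [map_iSup]⟩

/-- A pair of frame maps extends to the main components as soon as the copairing into the target
respects the congruence `C_L`. -/
theorem exists_main_of_con (L : Biframe.{u}) {M : Type v} [Order.Frame M] (f : FrameHom L.pos M)
    (g : FrameHom L.neg M)
    (h : ∀ x y, L.con.r x y → FrmCoprod.desc f g x = FrmCoprod.desc f g y) :
    ∃ k : FrameHom L.main M, (∀ a, k (L.ePos a) = f a) ∧ (∀ b, k (L.eNeg b) = g b) := by
  obtain ⟨k, hk⟩ := FrameHom.exists_factor _ L.desc_surjective (FrmCoprod.desc f g) h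
  exact ⟨k, fun a => by simpa using hk (FrmCoprod.inl a),
    fun b => by simpa using hk (FrmCoprod.inr b)⟩

end Biframe

/-! ### Finitary elements and the congruences they generate -/

namespace FrmCoprod

variable {A B : Type u} [Order.Frame A] [Order.Frame B]

theorem IsFin.inf {x y : FrmCoprod A B} (hx : IsFin x) (hy : IsFin y) : IsFin (x ⊓ y) := by
  classical
  obtain ⟨s, rfl⟩ := hx
  obtain ⟨t, rfl⟩ := hy
  refine ⟨(s ×ˢ t).image fun p => p.1 ⊓ p.2, ?_⟩
  rw [Finset.sup_inf_sup, Finset.sup_image]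
  refine Finset.sup_congr rfl fun p _ => ?_
  simp only [Function.comp_apply, Prod.fst_inf, Prod.snd_inf, map_inf]
  exact inf_inf_inf_comm _ _ _ _

/-- By distributivity, a finitary element is a finite meet of elements `a ⊔ b`. -/
theorem IsFin.exists_eq_inf {x : FrmCoprod A B} (hx : IsFin x) :
    ∃ t : Finset (A × B), x = t.inf fun p => inl p.1 ⊔ inr p.2 := by
  classical
  obtain ⟨s, rfl⟩ := hx
  induction s using Finset.induction_on with
  -- The empty join is `⊥ ⊔ ⊥`; the empty meet would be `⊤`.
  | empty => exact ⟨{(⊥, ⊥)}, by simp⟩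
  | insert p s _ ih =>
    obtain ⟨t, ht⟩ := ih
    -- With `m` the meet over `t`, `(a ⊓ b) ⊔ m = (a ⊔ m) ⊓ (b ⊔ m)`; then `a` is absorbed into the
    -- first coordinate of each factor of `m`, and `b` into the second.
    refine ⟨t.image (fun q => (p.1 ⊔ q.1, q.2)) ∪ t.image (fun q => (q.1, p.2 ⊔ q.2)), ?_⟩
    rw [Finset.sup_insert, ht, sup_inf_right, Finset.inf_union, Finset.inf_image,
      Finset.inf_image, Finset.inf_sup_distrib_left, Finset.inf_sup_distrib_left]
    congr 1
    · refine Finset.inf_congr rfl fun q _ => ?_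
      simp only [Function.comp_apply, map_sup, sup_assoc]
    · refine Finset.inf_congr rfl fun q _ => ?_
      simp only [Function.comp_apply, map_sup]
      exact sup_left_comm _ _ _

end FrmCoprod

theorem FrameCon.gen_of_rel {L : Type u} [Order.Frame L] {R : L → L → Prop} {x y : L}
    (h : R x y) : (FrameCon.gen R).r (x ⊓ y) x := fun _ hθ => hθ x y h

/-- In the quotient a finite join lies below a finite meet as soon as each joinand lies below each
meetand. Together with the converse observation `FrameHom.le_of_sup_eq_inf` this breaks finitary
inequalities into elementary ones. -/
theorem FrameCon.gen_sup_inf {L : Type u} [Order.Frame L] {R : L → L → Prop} {ι : Type w}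
    {s t : Finset ι} {f g : ι → L} (h : ∀ p ∈ s, ∀ q ∈ t, R (f p) (g q)) :
    (FrameCon.gen R).r (s.sup f ⊓ t.inf g) (s.sup f) := by
  rw [← FrameCon.proj_eq_iff, map_inf, inf_eq_left, map_finset_sup, map_finset_inf]
  exact Finset.sup_le fun p hp => Finset.le_inf fun q hq => FrameCon.gen_proj_le (h p hp q hq)

theorem FrameHom.le_of_sup_eq_inf {L : Type u} {M : Type v} [Order.Frame L] [Order.Frame M]
    (k : FrameHom L M) {ι : Type w} {s t : Finset ι} {f g : ι → L}
    (h : k (s.sup f) = k (t.inf g)) {p q : ι} (hp : p ∈ s) (hq : q ∈ t) : k (f p) ≤ k (g q) :=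
  (OrderHomClass.mono k (Finset.le_sup hp)).trans
    (h.le.trans (OrderHomClass.mono k (Finset.inf_le hq)))

namespace Biframe

/-- `finRel` consists of congruent pairs, while the relations at hand are inequalities. The
inequality `x ≤ y` modulo `C_L` is the congruence of `x` and `x ⊓ y`, and this pair is still
finitary because finitary elements are closed under binary meets. -/
theorem gen_finRel_of_con (L : Biframe.{u}) {x y : FrmCoprod L.pos L.neg}
    (h : L.con.r (x ⊓ y) x) (hx : FrmCoprod.IsFin x) (hy : FrmCoprod.IsFin y) :
    (FrameCon.gen L.finRel).r (x ⊓ y) x := by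
  have h' : L.finRel x (x ⊓ y) := ⟨L.con.iseqv.symm h, hx, hx.inf hy⟩
  have := FrameCon.gen_of_rel h'
  rwa [← inf_assoc, inf_idem] at this

/-- A finitary relation in `C_L` follows from inequalities `a ⊓ b ≤ a' ⊔ b'`. -/
theorem gen_of_finRel (L : Biframe.{u}) {R : FrmCoprod L.pos L.neg → FrmCoprod L.pos L.neg → Prop}
    (hR : ∀ p q : L.pos × L.neg, L.ePos p.1 ⊓ L.eNeg p.2 ≤ L.ePos q.1 ⊔ L.eNeg q.2 →
      R (FrmCoprod.inl p.1 ⊓ FrmCoprod.inr p.2) (FrmCoprod.inl q.1 ⊔ FrmCoprod.inr q.2))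
    {x y : FrmCoprod L.pos L.neg} (hxy : L.finRel x y) : (FrameCon.gen R).r (x ⊓ y) x := by
  obtain ⟨h, ⟨s, rfl⟩, hy⟩ := hxy
  -- The left side stays a join of elements `a ⊓ b`, whereas the right side is rewritten as a meet
  -- of elements `a ⊔ b`, so that the inequality splits over pairs.
  obtain ⟨t, rfl⟩ := hy.exists_eq_inf
  refine FrameCon.gen_sup_inf fun p hp q hq => hR p q ?_
  have h1 := FrameHom.le_of_sup_eq_inf _ h hp hq
  rwa [map_inf, map_sup, FrmCoprod.desc_inl, FrmCoprod.desc_inr, FrmCoprod.desc_inl,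
    FrmCoprod.desc_inr] at h1

/-- Whichever finitary relation generates `C_L`, each of its pairs is an inequality valid modulo
`C_L`, hence valid modulo `fin(C_L)`. So `fin(C_L)` is the canonical choice of generators. -/
theorem IsFinitary.con_eq {L : Biframe.{u}} (h : IsFinitary L) :
    L.con = FrameCon.gen L.finRel := by
  obtain ⟨R, hR, e⟩ := h
  apply FrameCon.ext
  ext x y
  refine ⟨?_, fun h => L.desc_eq_of_finRel h⟩
  intro hxy
  rw [e] at hxy
  refine FrameCon.gen_le (fun a b hab => ?_) hxy
  refine L.gen_finRel_of_con ?_ (hR a b hab).1 (hR a b hab).2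
  rw [e]
  exact FrameCon.gen_of_rel hab

end Biframe

/-- An inclusion `U⁺ ∩ U⁻ ⊆ V⁺ ∪ V⁻` is an inequality in the patch frame between finitary elements,
and conversely every congruent pair of finitary elements decomposes into such inclusions. -/
theorem BiTop.gen_finRel_eq (X : BiTop.{u}) :
    FrameCon.gen X.FinRel = FrameCon.gen X.bOmegaObj.finRel := by
  apply FrameCon.ext
  ext x y
  constructor
  · refine FrameCon.gen_le ?_
    rintro _ _ ⟨U, V, U', V', h⟩
    exact X.bOmegaObj.gen_finRel_of_con
      (X.desc_eq_of_finRel (FrameCon.gen_of_rel (.mk U V U' V' h)))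
      (FrmCoprod.isFin_inf U U') (FrmCoprod.isFin_sup V V')
  · exact FrameCon.gen_le fun _ _ h =>
      X.bOmegaObj.gen_of_finRel (fun _ _ h => .mk _ _ _ _ fun _ hz => h hz) h

/-! ### The coreflection -/

namespace Biframe

/-- The morphism `L → fin(L)`, for finitary `L`, with identities as components. -/
def toFin (L : BiFrmFin.{u}) : Hom L.obj L.obj.fin :=
  ⟨FrameHom.id _, FrameHom.id _, L.obj.exists_main_of_con _ _ fun x y h => by
    have e : FrmCoprod.desc (L.obj.fin.ePos.comp (FrameHom.id _))
        (L.obj.fin.eNeg.comp (FrameHom.id _)) = (FrameCon.gen L.obj.finRel).proj :=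
      FrmCoprod.hom_ext (fun a => FrmCoprod.desc_inl _ _ a) (fun b => FrmCoprod.desc_inr _ _ b)
    -- Finitarity enters here: the quotient map onto the main component of `fin(L)` kills no more
    -- than `fin(C_L)`, which must contain all of `C_L`.
    rw [L.property.con_eq] at h
    exact (DFunLike.congr_fun e x).trans
      (((FrameCon.proj_eq_iff _).2 h).trans (DFunLike.congr_fun e y).symm)⟩

/-- The morphism `fin(L) → L` with identities as components. -/
def ofFin (L : Biframe.{u}) : Hom L.fin L :=
  ⟨FrameHom.id _, FrameHom.id _,
    FrameCon.lift (FrmCoprod.desc L.ePos L.eNeg) (fun {_ _} h => L.desc_eq_of_finRel h),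
    fun a => (FrameCon.lift_proj (θ := FrameCon.gen L.finRel) _ _ _).trans
      (FrmCoprod.desc_inl _ _ a),
    fun b => (FrameCon.lift_proj (θ := FrameCon.gen L.finRel) _ _ _).trans
      (FrmCoprod.desc_inr _ _ b)⟩

end Biframe

/-- The coreflection of biframes in finitary biframes. -/
def finAdjunction : finIncl.{u} ⊣ finFunctor.{u} :=
  Adjunction.mkOfUnitCounit
    { unit := { app := fun L => ObjectProperty.homMk (Biframe.toFin L) }
      counit := { app := fun L => Biframe.ofFin L } }

theorem isIso_finAdjunction_unit (L : BiFrmFin.{u}) : IsIso (finAdjunction.unit.app L) :=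
  ⟨ObjectProperty.homMk (Biframe.ofFin L.obj), rfl, rfl⟩

/-! ### The adjunction `Γ ⊣ Δ` -/

namespace DFrame

/-- The pair of quotient maps, as a morphism `L → ΔΓ(L)`. -/
def toDeltaGamma (L : DFrame.{u}) : Hom L L.gamma.delta :=
  ⟨L.toGammaPos, L.toGammaNeg,
    fun a b h => by
      change L.gamma.ePos (L.toGammaPos a) ⊓ L.gamma.eNeg (L.toGammaNeg b) = ⊥
      rw [gamma_ePos, gamma_eNeg, L.syn_con h],
    fun a b h => by
      change L.gamma.ePos (L.toGammaPos a) ⊔ L.gamma.eNeg (L.toGammaNeg b) = ⊤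
      rw [gamma_ePos, gamma_eNeg, L.syn_tot h]⟩

/-- Preservation of `con` and `tot` by a map into `Δ(M)` says precisely that the defining relations
of `GammaMain` hold in the main component of `M`. -/
theorem exists_gammaDesc (L : DFrame.{u}) {M : Biframe.{v}} (f : Hom L M.delta) :
    ∃ g : Biframe.Hom L.gamma M, (∀ a, g.pos (L.toGammaPos a) = f.pos a) ∧
      (∀ b, g.neg (L.toGammaNeg b) = f.neg b) := by
  obtain ⟨k, hk, hk'⟩ := L.exists_gammaLift (M.ePos.comp f.pos) (M.eNeg.comp f.neg)
    f.map_con f.map_tot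
  -- Elements identified in `GammaMain` have equal images under `k` in the main component of `M`; as
  -- `M⁺` embeds there, they already have equal images in `M⁺`.
  have hp : ∀ {x y}, (FrameCon.ker L.synPos).r x y → f.pos x = f.pos y := fun {x y} h =>
    M.ePos_injective ((hk x).symm.trans ((congrArg k h).trans (hk y)))
  have hn : ∀ {x y}, (FrameCon.ker L.synNeg).r x y → f.neg x = f.neg y := fun {x y} h =>
    M.eNeg_injective ((hk' x).symm.trans ((congrArg k h).trans (hk' y)))
  refine ⟨⟨FrameCon.lift f.pos hp, FrameCon.lift f.neg hn, k, fun p => ?_, fun q => ?_⟩,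
    fun a => FrameCon.lift_proj _ hp a, fun b => FrameCon.lift_proj _ hn b⟩
  · obtain ⟨a, rfl⟩ := FrameCon.proj_surjective _ p
    rw [FrameCon.lift_proj]
    exact (congrArg k (L.gamma_ePos a)).trans (hk a)
  · obtain ⟨b, rfl⟩ := FrameCon.proj_surjective _ q
    rw [FrameCon.lift_proj]
    exact (congrArg k (L.gamma_eNeg b)).trans (hk' b)

/-- The biframe map `Γ(L) → M` induced by a d-frame map `L → Δ(M)`. -/
noncomputable def gammaDesc (L : DFrame.{u}) {M : Biframe.{v}} (f : Hom L M.delta) :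
    Biframe.Hom L.gamma M := (L.exists_gammaDesc f).choose

@[simp]
theorem gammaDesc_pos (L : DFrame.{u}) {M : Biframe.{v}} (f : Hom L M.delta) (a : L.pos) :
    (L.gammaDesc f).pos (L.toGammaPos a) = f.pos a := (L.exists_gammaDesc f).choose_spec.1 a

@[simp]
theorem gammaDesc_neg (L : DFrame.{u}) {M : Biframe.{v}} (f : Hom L M.delta) (b : L.neg) :
    (L.gammaDesc f).neg (L.toGammaNeg b) = f.neg b := (L.exists_gammaDesc f).choose_spec.2 b

theorem toGammaPos_bijective (L : DFrame.{u}) (h : Function.Injective L.synPos) :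
    Function.Bijective L.toGammaPos :=
  ⟨fun _ _ e => h ((FrameCon.proj_eq_iff (FrameCon.ker L.synPos)).1 e),
    FrameCon.proj_surjective _⟩

theorem toGammaNeg_bijective (L : DFrame.{u}) (h : Function.Injective L.synNeg) :
    Function.Bijective L.toGammaNeg :=
  ⟨fun _ _ e => h ((FrameCon.proj_eq_iff (FrameCon.ker L.synNeg)).1 e),
    FrameCon.proj_surjective _⟩

end DFrame

/-- The adjunction `Γ ⊣ Δ`. -/
noncomputable def gammaDeltaAdjunction : Gamma.{u} ⊣ Delta.{u} :=
  Adjunction.mkOfUnitCounit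
    { unit :=
        { app := fun L => L.toDeltaGamma
          naturality := fun L M f => DFrame.Hom.ext
            (FrameHom.ext fun a => (DFrame.gammaMap_pos f a).symm)
            (FrameHom.ext fun b => (DFrame.gammaMap_neg f b).symm) }
      counit :=
        { app := fun L => ObjectProperty.homMk
            (L.obj.delta.gammaDesc (DFrame.Hom.id L.obj.delta))
          naturality := fun L M f => ObjectProperty.hom_ext _ (DFrame.gamma_hom_ext
            (fun a => (congrArg (M.obj.delta.gammaDesc (DFrame.Hom.id M.obj.delta)).pos
                (DFrame.gammaMap_pos (Delta.map f) a)).trans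
              ((DFrame.gammaDesc_pos _ _ _).trans
                (congrArg f.hom.pos
                  (DFrame.gammaDesc_pos _ (DFrame.Hom.id L.obj.delta) a)).symm))
            (fun b => (congrArg (M.obj.delta.gammaDesc (DFrame.Hom.id M.obj.delta)).neg
                (DFrame.gammaMap_neg (Delta.map f) b)).trans
              ((DFrame.gammaDesc_neg _ _ _).trans
                (congrArg f.hom.neg
                  (DFrame.gammaDesc_neg _ (DFrame.Hom.id L.obj.delta) b)).symm))) }
      -- On the class of `a`, `Γ` of the unit gives the class of that class, and the counit strips
      -- the outer one.
      left_triangle := by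
        apply NatTrans.ext
        funext L
        refine ObjectProperty.hom_ext _ (DFrame.gamma_hom_ext (fun a => ?_) (fun b => ?_))
        · exact (congrArg (L.gamma.delta.gammaDesc (DFrame.Hom.id L.gamma.delta)).pos
            (DFrame.gammaMap_pos (M := L.gamma.delta) L.toDeltaGamma a)).trans
            (DFrame.gammaDesc_pos _ _ _)
        · exact (congrArg (L.gamma.delta.gammaDesc (DFrame.Hom.id L.gamma.delta)).neg
            (DFrame.gammaMap_neg (M := L.gamma.delta) L.toDeltaGamma b)).trans
            (DFrame.gammaDesc_neg _ _ _)
      right_triangle := by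
        ext L
        exact DFrame.Hom.ext (FrameHom.ext fun a => DFrame.gammaDesc_pos _ _ a)
          (FrameHom.ext fun b => DFrame.gammaDesc_neg _ _ b) }

/-! ### The adjunction `bΩ ⊣ bpt` -/

/-- The point of a frame of opens given by a point of the space. -/
def TopologicalSpace.Opens.pointHom {T : Type u} [TopologicalSpace T] (x : T) :
    FrameHom (Opens T) Prop where
  toFun U := x ∈ U
  map_inf' _ _ := rfl
  map_top' := rfl
  map_sSup' S := by simp [sSup_image, iSup_Prop_eq]

namespace BiTop

/-- The pair of neighbourhood maps of a point. -/
def point (X : BiTop.{u}) (x : X.carrier) : Biframe.Hom X.bOmegaObj Biframe.two :=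
  ⟨Opens.pointHom (T := X.P) x, Opens.pointHom (T := X.N) x, Opens.pointHom (T := X.Patch) x,
    fun _ => rfl, fun _ => rfl⟩

/-- The unit of `bΩ ⊣ bpt`. -/
def toBpt (X : BiTop.{u}) : Hom X X.bOmegaObj.bptObj where
  toFun := X.point
  continuous_pos := by
    refine @Continuous.mk _ _ X.pos (_) _ ?_
    rintro _ ⟨U, rfl⟩
    exact U.2
  continuous_neg := by
    refine @Continuous.mk _ _ X.neg (_) _ ?_
    rintro _ ⟨U, rfl⟩
    exact U.2

end BiTop

namespace Biframe

/-- The positive open of the bispectrum given by an element of `L⁺`. -/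
def spatPos (L : Biframe.{u}) : FrameHom L.pos (Opens L.bptObj.P) where
  toFun a := ⟨{p : L.bptObj.carrier | p.pos a}, a, rfl⟩
  map_inf' a b := Opens.ext (Set.ext fun p => by
    change p.pos (a ⊓ b) ↔ p.pos a ∧ p.pos b
    rw [map_inf]; rfl)
  map_top' := Opens.ext (Set.ext fun p => by
    change p.pos ⊤ ↔ True
    rw [map_top]; rfl)
  map_sSup' S := Opens.ext (Set.ext fun p => by
    rw [SetLike.mem_coe, SetLike.mem_coe, sSup_image]
    refine Iff.trans ?_ (Opens.mem_iSup (α := L.bptObj.P)).symm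
    change p.pos (sSup S) ↔ _
    rw [map_sSup, sSup_image, iSup_Prop_eq]
    refine exists_congr fun a => ?_
    refine Iff.trans ?_ (Opens.mem_iSup (α := L.bptObj.P)).symm
    rw [iSup_Prop_eq]
    rfl)

/-- The negative open of the bispectrum given by an element of `L⁻`. -/
def spatNeg (L : Biframe.{u}) : FrameHom L.neg (Opens L.bptObj.N) where
  toFun a := ⟨{p : L.bptObj.carrier | p.neg a}, a, rfl⟩
  map_inf' a b := Opens.ext (Set.ext fun p => by
    change p.neg (a ⊓ b) ↔ p.neg a ∧ p.neg b
    rw [map_inf]; rfl)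
  map_top' := Opens.ext (Set.ext fun p => by
    change p.neg ⊤ ↔ True
    rw [map_top]; rfl)
  map_sSup' S := Opens.ext (Set.ext fun p => by
    rw [SetLike.mem_coe, SetLike.mem_coe, sSup_image]
    refine Iff.trans ?_ (Opens.mem_iSup (α := L.bptObj.N)).symm
    change p.neg (sSup S) ↔ _
    rw [map_sSup, sSup_image, iSup_Prop_eq]
    refine exists_congr fun a => ?_
    refine Iff.trans ?_ (Opens.mem_iSup (α := L.bptObj.N)).symm
    rw [iSup_Prop_eq]
    rfl)

/-- The spatialization of a biframe. -/
def spat (L : Biframe.{u}) : Hom L L.bptObj.bOmegaObj where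
  pos := L.spatPos
  neg := L.spatNeg
  exists_main := L.exists_main_of_con
      (L.bptObj.bOmegaObj.ePos.comp L.spatPos) (L.bptObj.bOmegaObj.eNeg.comp L.spatNeg) fun x y h => by
    -- Membership of `p` in the patch-open attached to an element of `L⁺ ⊕ L⁻` is computed by the
    -- extension `k` of `p`, hence depends only on the image of that element in the main component.
    have key : ∀ (p : L.bptObj.carrier) (k : FrameHom L.main Prop),
        (∀ a, k (L.ePos a) = p.pos a) → (∀ b, k (L.eNeg b) = p.neg b) →
        (Opens.pointHom (T := L.bptObj.Patch) p).comp
          (FrmCoprod.desc (L.bptObj.bOmegaObj.ePos.comp L.spatPos)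
            (L.bptObj.bOmegaObj.eNeg.comp L.spatNeg)) =
        k.comp (FrmCoprod.desc L.ePos L.eNeg) := fun p k hp hn => by
      refine FrmCoprod.hom_ext (fun a => ?_) (fun b => ?_)
      · rw [FrameHom.comp_apply, FrameHom.comp_apply, FrmCoprod.desc_inl, FrmCoprod.desc_inl, hp]
        rfl
      · rw [FrameHom.comp_apply, FrameHom.comp_apply, FrmCoprod.desc_inr, FrmCoprod.desc_inr, hn]
        rfl
    refine Opens.ext (Set.ext fun (p : L.bptObj.carrier) => ?_)
    obtain ⟨k, hp, hn⟩ := Hom.exists_main (M := Biframe.two) p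
    exact iff_of_eq ((DFunLike.congr_fun (key p k hp hn) x).trans
      ((congrArg k h).trans (DFunLike.congr_fun (key p k hp hn) y).symm))

end Biframe

/-- The adjunction between bispaces and biframes. -/
def bOmegaAdjunction : bOmega.{u} ⊣ bpt.{u} :=
  Adjunction.mkOfUnitCounit
    { unit := { app := fun X => X.toBpt }
      counit :=
        { app := fun L => Quiver.Hom.op (Biframe.spat L.unop)
          naturality := fun _ _ _ => rfl }
      left_triangle := rfl
      right_triangle := rfl }

/-! ### The bispectrum of `Γ(L)` -/

namespace DFrame

/-- The d-point of `L` underlying a bipoint of `Γ(L)`. -/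
def dpoint (L : DFrame.{u}) (p : Biframe.Hom L.gamma Biframe.two) : Hom L two :=
  L.toDeltaGamma.comp
    -- This is `Δ` applied to `p`, spelled out because `𝟐` lives in universe `0`, whereas `deltaMap`
    -- stays within one universe.
    ⟨p.pos, p.neg, fun a b h => by
      obtain ⟨k, h1, h2⟩ := p.exists_main
      change p.pos a ⊓ p.neg b = ⊥
      change L.gamma.ePos a ⊓ L.gamma.eNeg b = ⊥ at h
      have := congrArg k h
      rw [map_inf, h1, h2, map_bot] at this
      exact this,
    fun a b h => by
      obtain ⟨k, h1, h2⟩ := p.exists_main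
      change p.pos a ⊔ p.neg b = ⊤
      change L.gamma.ePos a ⊔ L.gamma.eNeg b = ⊤ at h
      have := congrArg k h
      rw [map_sup, h1, h2, map_top] at this
      exact this⟩

/-- The bihomeomorphism between the bipoints of `Γ(L)` and the d-points of `L`. -/
noncomputable def bptGammaIso (L : DFrame.{u}) : L.gamma.bptObj ≅ L.dptObj where
  hom := ⟨L.dpoint, continuous_spectralTopology _ L.toGammaPos fun _ _ => rfl,
    continuous_spectralTopology _ L.toGammaNeg fun _ _ => rfl⟩
  inv :=
    { toFun := fun f => L.gammaDesc f
      continuous_pos := by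
        refine @Continuous.mk _ _ (_) (_) _ ?_
        rintro _ ⟨a, rfl⟩
        -- Every positive open of the bispectrum of `Γ(L)` comes from the class of some `a : L.pos`,
        -- and its preimage is the open of d-points given by `a`.
        obtain ⟨a, rfl⟩ := FrameCon.proj_surjective _ a
        exact ⟨a, Set.ext fun p => iff_of_eq (L.gammaDesc_pos p a)⟩
      continuous_neg := by
        refine @Continuous.mk _ _ (_) (_) _ ?_
        rintro _ ⟨a, rfl⟩
        obtain ⟨a, rfl⟩ := FrameCon.proj_surjective _ a
        exact ⟨a, Set.ext fun p => iff_of_eq (L.gammaDesc_neg p a)⟩ }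
  hom_inv_id := BiTop.Hom.ext (funext fun p => gamma_hom_ext
    (fun a => L.gammaDesc_pos (L.dpoint p) a) (fun b => L.gammaDesc_neg (L.dpoint p) b))
  inv_hom_id := BiTop.Hom.ext (funext fun f => Hom.ext
    (FrameHom.ext fun a => L.gammaDesc_pos f a) (FrameHom.ext fun b => L.gammaDesc_neg f b))

end DFrame

/-- The natural bihomeomorphism `bpt ∘ Γ ≅ dpt`. -/
noncomputable def gammaBptIso : Gamma.{u}.op ⋙ bptFin.{u} ≅ dpt.{u} :=
  NatIso.ofComponents (fun L => L.unop.bptGammaIso) fun f =>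
    BiTop.Hom.ext (funext fun p => DFrame.Hom.ext
      (FrameHom.ext fun a => congrArg p.pos (DFrame.gammaMap_pos f.unop a))
      (FrameHom.ext fun b => congrArg p.neg (DFrame.gammaMap_neg f.unop b)))

/-! ### Identifications of the functors of opens -/

section

variable {A B : Type u} [Order.Frame A] [Order.Frame B] {c c' t t' : Set (A × B)}
  {h₁ h₂ h₃ h₄ h₅ h₆ h₇ h₈ h₉ h₁₀ h₁' h₂' h₃' h₄' h₅' h₆' h₇' h₈' h₉' h₁₀'}

theorem DFrame.mk_congr (hc : c = c') (ht : t = t') :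
    DFrame.mk A B c t h₁ h₂ h₃ h₄ h₅ h₆ h₇ h₈ h₉ h₁₀ =
      DFrame.mk A B c' t' h₁' h₂' h₃' h₄' h₅' h₆' h₇' h₈' h₉' h₁₀' := by
  subst hc ht
  rfl

/-- The d-frames to be compared share their two frames and differ only in how `con` and `tot` are
described. Keeping these as variables allows the equalities to be eliminated, after which the
transport is an identity. -/
theorem DFrame.eqToHom_op_apply (hc : c = c') (ht : t = t')
    (h : (Opposite.op (DFrame.mk A B c t h₁ h₂ h₃ h₄ h₅ h₆ h₇ h₈ h₉ h₁₀) : DFrm.{u}ᵒᵖ) =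
      Opposite.op (DFrame.mk A B c' t' h₁' h₂' h₃' h₄' h₅' h₆' h₇' h₈' h₉' h₁₀')) :
    (∀ a : A, (eqToHom h).unop.pos a = a) ∧ (∀ b : B, (eqToHom h).unop.neg b = b) := by
  subst hc ht
  exact ⟨fun _ => rfl, fun _ => rfl⟩

end

/-- Both `a ⊓ b` and `⊥` (the empty join) are finitary, so they are congruent modulo `C_L` iff they
are congruent modulo `fin(C_L)`. The argument for `tot` is the same, with `a ⊔ b` and `⊤`. -/
theorem Biframe.con_delta_fin (L : Biframe.{u}) : L.fin.delta.con = L.delta.con := by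
  ext ⟨a, b⟩
  have h : FrmCoprod.desc L.ePos L.eNeg (FrmCoprod.inl a ⊓ FrmCoprod.inr b) =
      L.ePos a ⊓ L.eNeg b := by
    rw [map_inf, FrmCoprod.desc_inl, FrmCoprod.desc_inr]
  change (FrameCon.gen L.finRel).proj (FrmCoprod.inl a) ⊓
    (FrameCon.gen L.finRel).proj (FrmCoprod.inr b) = ⊥ ↔ L.ePos a ⊓ L.eNeg b = ⊥
  rw [← map_inf, ← map_bot (FrameCon.gen L.finRel).proj, FrameCon.proj_eq_iff, ← h,
    ← map_bot (FrmCoprod.desc L.ePos L.eNeg)]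
  refine ⟨fun h => L.desc_eq_of_finRel h, fun h => ?_⟩
  have := L.gen_finRel_of_con (x := FrmCoprod.inl a ⊓ FrmCoprod.inr b) (y := ⊥)
    (by rw [inf_bot_eq]; exact h.symm) (FrmCoprod.isFin_inf a b) ⟨∅, rfl⟩
  rw [inf_bot_eq] at this
  exact (FrameCon.gen L.finRel).iseqv.symm this

theorem Biframe.tot_delta_fin (L : Biframe.{u}) : L.fin.delta.tot = L.delta.tot := by
  ext ⟨a, b⟩
  have h : FrmCoprod.desc L.ePos L.eNeg (FrmCoprod.inl a ⊔ FrmCoprod.inr b) =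
      L.ePos a ⊔ L.eNeg b := by
    rw [map_sup, FrmCoprod.desc_inl, FrmCoprod.desc_inr]
  change (FrameCon.gen L.finRel).proj (FrmCoprod.inl a) ⊔
    (FrameCon.gen L.finRel).proj (FrmCoprod.inr b) = ⊤ ↔ L.ePos a ⊔ L.eNeg b = ⊤
  rw [← map_sup, ← map_top (FrameCon.gen L.finRel).proj, FrameCon.proj_eq_iff, ← h,
    ← map_top (FrmCoprod.desc L.ePos L.eNeg)]
  refine ⟨fun h => L.desc_eq_of_finRel h, fun h => ?_⟩
  have := L.gen_finRel_of_con (x := ⊤) (y := FrmCoprod.inl a ⊔ FrmCoprod.inr b)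
    (by rw [top_inf_eq]; exact h) ⟨{⊤}, by simp⟩ (FrmCoprod.isFin_sup a b)
  rwa [top_inf_eq] at this

theorem BiTop.con_delta_bOmegaObj (X : BiTop.{u}) : X.dOmegaObj.con = X.bOmegaObj.delta.con := by
  ext ⟨U, V⟩
  exact ⟨fun h => Opens.ext h, fun h => congrArg SetLike.coe h⟩

theorem BiTop.tot_delta_bOmegaObj (X : BiTop.{u}) : X.dOmegaObj.tot = X.bOmegaObj.delta.tot := by
  ext ⟨U, V⟩
  exact ⟨fun h => Opens.ext h, fun h => congrArg SetLike.coe h⟩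

theorem dOmega_eq : dOmega.{u} = bOmega ⋙ DeltaAll.op := by
  refine CategoryTheory.Functor.ext (fun X => congrArg Opposite.op
    (DFrame.mk_congr X.con_delta_bOmegaObj X.tot_delta_bOmegaObj)) fun X Y f =>
      Quiver.Hom.unop_inj ?_
  have hX (h : (Opposite.op X.dOmegaObj : DFrm.{u}ᵒᵖ) = Opposite.op X.bOmegaObj.delta) :=
    DFrame.eqToHom_op_apply X.con_delta_bOmegaObj X.tot_delta_bOmegaObj h
  have hY (h : (Opposite.op Y.bOmegaObj.delta : DFrm.{u}ᵒᵖ) = Opposite.op Y.dOmegaObj) :=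
    DFrame.eqToHom_op_apply Y.con_delta_bOmegaObj.symm Y.tot_delta_bOmegaObj.symm h
  refine DFrame.Hom.ext (FrameHom.ext fun U => ?_) (FrameHom.ext fun V => ?_)
  · exact .symm <| ((hX _).1 _).trans (congrArg (Opens.comap (BiTop.Hom.P f)) ((hY _).1 U))
  · exact .symm <| ((hX _).2 _).trans (congrArg (Opens.comap (BiTop.Hom.N f)) ((hY _).2 V))

theorem BiTop.con_delta_fin_bOmegaObj (X : BiTop.{u}) :
    X.dOmegaObj.con = X.bOmegaObj.fin.delta.con :=
  X.con_delta_bOmegaObj.trans X.bOmegaObj.con_delta_fin.symm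

theorem BiTop.tot_delta_fin_bOmegaObj (X : BiTop.{u}) :
    X.dOmegaObj.tot = X.bOmegaObj.fin.delta.tot :=
  X.tot_delta_bOmegaObj.trans X.bOmegaObj.tot_delta_fin.symm

theorem dOmega_eq_fin : dOmega.{u} = (bOmega ⋙ finFunctor.op) ⋙ Delta.op := by
  refine CategoryTheory.Functor.ext (fun X => congrArg Opposite.op
    (DFrame.mk_congr X.con_delta_fin_bOmegaObj X.tot_delta_fin_bOmegaObj)) fun X Y f =>
      Quiver.Hom.unop_inj ?_
  have hX (h : (Opposite.op X.dOmegaObj : DFrm.{u}ᵒᵖ) = Opposite.op X.bOmegaObj.fin.delta) :=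
    DFrame.eqToHom_op_apply X.con_delta_fin_bOmegaObj X.tot_delta_fin_bOmegaObj h
  have hY (h : (Opposite.op Y.bOmegaObj.fin.delta : DFrm.{u}ᵒᵖ) = Opposite.op Y.dOmegaObj) :=
    DFrame.eqToHom_op_apply Y.con_delta_fin_bOmegaObj.symm Y.tot_delta_fin_bOmegaObj.symm h
  refine DFrame.Hom.ext (FrameHom.ext fun U => ?_) (FrameHom.ext fun V => ?_)
  · exact .symm <| ((hX _).1 _).trans (congrArg (Opens.comap (BiTop.Hom.P f)) ((hY _).1 U))
  · exact .symm <| ((hX _).2 _).trans (congrArg (Opens.comap (BiTop.Hom.N f)) ((hY _).2 V))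

theorem Biframe.ofCon_congr {A B : Type u} [Order.Frame A] [Order.Frame B]
    {θ θ' : FrameCon (FrmCoprod A B)} (e : θ = θ') {hl hr hl' hr'} :
    Biframe.ofCon θ hl hr = Biframe.ofCon θ' hl' hr' := by
  subst e
  rfl

/-- The same pair `(f, g)` gives morphisms for either presentation of the main components. With the
congruences as variables both transports become identities; this is the morphism part of `bΩ_fin =
fin ∘ bΩ`. -/
theorem Biframe.homMk_op_eq_eqToHom_comp {A B A' B' : Type u} [Order.Frame A] [Order.Frame B]
    [Order.Frame A'] [Order.Frame B'] {θ η : FrameCon (FrmCoprod A B)}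
    {θ' η' : FrameCon (FrmCoprod A' B')} (e : θ = η) (e' : θ' = η')
    {hl hr hF kl kr kF hl' hr' hF' kl' kr' kF'} (f : FrameHom A' A) (g : FrameHom B' B)
    (hf : ∃ k : FrameHom θ'.Quo θ.Quo,
      (∀ a, k ((ofCon θ' hl' hr').ePos a) = (ofCon θ hl hr).ePos (f a)) ∧
      (∀ b, k ((ofCon θ' hl' hr').eNeg b) = (ofCon θ hl hr).eNeg (g b)))
    (hg : ∃ k : FrameHom η'.Quo η.Quo,
      (∀ a, k ((ofCon η' kl' kr').ePos a) = (ofCon η kl kr).ePos (f a)) ∧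
      (∀ b, k ((ofCon η' kl' kr').eNeg b) = (ofCon η kl kr).eNeg (g b)))
    (h : (Opposite.op ⟨ofCon θ hl hr, hF⟩ : BiFrmFin.{u}ᵒᵖ) = Opposite.op ⟨ofCon η kl kr, kF⟩)
    (h' : (Opposite.op ⟨ofCon η' kl' kr', kF'⟩ : BiFrmFin.{u}ᵒᵖ) =
      Opposite.op ⟨ofCon θ' hl' hr', hF'⟩) :
    Quiver.Hom.op (X := (⟨ofCon θ' hl' hr', hF'⟩ : BiFrmFin.{u}))
      (Y := (⟨ofCon θ hl hr, hF⟩ : BiFrmFin.{u})) (ObjectProperty.homMk (Hom.mk f g hf)) =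
    eqToHom h ≫ Quiver.Hom.op (X := (⟨ofCon η' kl' kr', kF'⟩ : BiFrmFin.{u}))
      (Y := (⟨ofCon η kl kr, kF⟩ : BiFrmFin.{u})) (ObjectProperty.homMk (Hom.mk f g hg)) ≫
      eqToHom h' := by
  subst e e'
  rw [eqToHom_refl, eqToHom_refl, Category.id_comp, Category.comp_id]

theorem bOmegaFin_eq : bOmegaFin.{u} = bOmega ⋙ finFunctor.op :=
  CategoryTheory.Functor.ext (fun X => congrArg Opposite.op
    (ObjectProperty.FullSubcategory.ext (Biframe.ofCon_congr X.gen_finRel_eq))) fun X Y f =>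
      Biframe.homMk_op_eq_eqToHom_comp X.gen_finRel_eq Y.gen_finRel_eq
        (Opens.comap (BiTop.Hom.P f)) (Opens.comap (BiTop.Hom.N f))
        (bOmegaFin.map f).unop.hom.exists_main
        ((bOmega ⋙ finFunctor.op).map f).unop.hom.exists_main _ _

/-! ### The composite adjunctions -/

/-- The adjunction between bispaces and finitary biframes. -/
def bOmegaFinAdjunction : bOmegaFin.{u} ⊣ bptFin.{u} :=
  (bOmegaAdjunction.comp finAdjunction.op).ofNatIsoLeft (eqToIso bOmegaFin_eq.symm)

/-- The adjunction between bispaces and d-frames. -/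
noncomputable def dOmegaAdjunction : dOmega.{u} ⊣ dpt.{u} :=
  (((bOmegaAdjunction.comp finAdjunction.op).comp gammaDeltaAdjunction.op).ofNatIsoLeft
    (eqToIso dOmega_eq_fin.symm)).ofNatIsoRight gammaBptIso

/-! ### Units and counits of the composite adjunctions -/

/-- For a variable functor `F` the equality `h` can be eliminated, and the formula becomes the
definition of the unit of a composite adjunction. -/
theorem unit_of_eq_comp_finAdjunction {F : BiTop.{u} ⥤ BiFrmFin.{u}ᵒᵖ}
    (h : bOmega ⋙ finFunctor.op = F) (adj : F ⊣ bptFin.{u})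
    (e : adj = (bOmegaAdjunction.comp finAdjunction.op).ofNatIsoLeft (eqToIso h))
    (X : BiTop.{u}) (x : X.carrier) :
    (adj.unit.app X).toFun x = Biframe.Hom.comp (eqToHom (Functor.congr_obj h X)).unop.hom
      (Biframe.Hom.comp X.bOmegaObj.ofFin (X.point x)) := by
  subst h e
  rfl

theorem Biframe.eqToHom_comp_ofFin (L : Biframe.{u}) {θ : FrameCon (FrmCoprod L.pos L.neg)}
    (e : θ = FrameCon.gen L.finRel) {hl hr hF}
    (h : (Opposite.op ⟨L.fin, L.fin_isFinitary⟩ : BiFrmFin.{u}ᵒᵖ) =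
      Opposite.op ⟨ofCon θ hl hr, hF⟩) (p : Biframe.Hom L Biframe.two) :
    (∀ a : L.pos, (Hom.comp (eqToHom h).unop.hom (Hom.comp L.ofFin p)).pos a = p.pos a) ∧
    (∀ b : L.neg, (Hom.comp (eqToHom h).unop.hom (Hom.comp L.ofFin p)).neg b = p.neg b) := by
  subst e
  exact ⟨fun _ => rfl, fun _ => rfl⟩

theorem bOmegaFinAdjunction_unit (X : BiTop.{u}) (x : X.carrier) :
    (∀ U : Opens X.P, ((bOmegaFinAdjunction.unit.app X).toFun x :
      Biframe.Hom X.bOmegaFinObj Biframe.two).pos U = (X.point x).pos U) ∧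
    (∀ V : Opens X.N, ((bOmegaFinAdjunction.unit.app X).toFun x :
      Biframe.Hom X.bOmegaFinObj Biframe.two).neg V = (X.point x).neg V) := by
  have e := unit_of_eq_comp_finAdjunction bOmegaFin_eq.symm bOmegaFinAdjunction rfl X x
  have e' := X.bOmegaObj.eqToHom_comp_ofFin X.gen_finRel_eq (hF := X.bOmegaFinObj_isFinitary)
    (congrArg Opposite.op (ObjectProperty.FullSubcategory.ext
      (Biframe.ofCon_congr X.gen_finRel_eq.symm))) (X.point x)
  exact ⟨fun U => (congrArg (fun q : Biframe.Hom X.bOmegaFinObj Biframe.two => q.pos U) e).trans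
      (e'.1 U),
    fun V => (congrArg (fun q : Biframe.Hom X.bOmegaFinObj Biframe.two => q.neg V) e).trans
      (e'.2 V)⟩

theorem dOmegaAdjunction_unit (X : BiTop.{u}) (x : X.carrier) :
    (∀ U : Opens X.P, ((dOmegaAdjunction.unit.app X).toFun x :
      DFrame.Hom X.dOmegaObj DFrame.two).pos U = (X.point x).pos U) ∧
    (∀ V : Opens X.N, ((dOmegaAdjunction.unit.app X).toFun x :
      DFrame.Hom X.dOmegaObj DFrame.two).neg V = (X.point x).neg V) := by
  have e := eqToHom_app dOmega_eq_fin.{u}.symm X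
  have hX (h : (Opposite.op X.bOmegaObj.fin.delta : DFrm.{u}ᵒᵖ) = Opposite.op X.dOmegaObj) :=
    DFrame.eqToHom_op_apply X.con_delta_fin_bOmegaObj.symm X.tot_delta_fin_bOmegaObj.symm h
  let f : X.dOmegaObj ⟶ X.bOmegaObj.fin.delta := ((eqToHom dOmega_eq_fin.{u}.symm).app X).unop
  let g := X.bOmegaObj.fin.delta.gammaDesc (DFrame.Hom.id X.bOmegaObj.fin.delta)
  constructor
  · intro U
    -- The composite unit unfolded, read from the inside: the class of `U` (from `gammaBptIso`), `Γ`
    -- of the transport `f` between the two d-frames, the counit `g` of `Γ ⊣ Δ`, and the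
    -- neighbourhood map. The coreflection contributes only identities.
    change (X.point x).pos (g.pos ((DFrame.gammaMap f).pos (X.dOmegaObj.toGammaPos U))) = _
    rw [DFrame.gammaMap_pos]
    refine congrArg (X.point x).pos ((DFrame.gammaDesc_pos _ _ _).trans ?_)
    change ((eqToHom dOmega_eq_fin.{u}.symm).app X).unop.pos U = U
    rw [e]
    exact (hX _).1 U
  · intro V
    change (X.point x).neg (g.neg ((DFrame.gammaMap f).neg (X.dOmegaObj.toGammaNeg V))) = _
    rw [DFrame.gammaMap_neg]
    refine congrArg (X.point x).neg ((DFrame.gammaDesc_neg _ _ _).trans ?_)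
    change ((eqToHom dOmega_eq_fin.{u}.symm).app X).unop.neg V = V
    rw [e]
    exact (hX _).2 V

/-- The right triangle identity says that precomposing the neighbourhood maps of `p` with the counit
gives back `p`. Hence `p` lies in the open assigned to `a` iff `p` takes `a` to `1`: the unit forces
the counit, with no transport to unwind. The argument for d-frames is identical. -/
theorem bOmegaFin_counit_of_unit (adj : bOmegaFin.{u} ⊣ bptFin.{u})
    (h : ∀ (X : BiTop.{u}) (x : X.carrier),
      (∀ U : Opens X.P, ((adj.unit.app X).toFun x :
        Biframe.Hom X.bOmegaFinObj Biframe.two).pos U = (X.point x).pos U) ∧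
      (∀ V : Opens X.N, ((adj.unit.app X).toFun x :
        Biframe.Hom X.bOmegaFinObj Biframe.two).neg V = (X.point x).neg V))
    (L : BiFrmFin.{u}) :
    (∀ a : L.obj.pos, BiTop.posSet (X := L.obj.bptObj)
      ((adj.counit.app (Opposite.op L)).unop.hom.pos a) =
        {p : L.obj.bptObj.carrier | p.pos a}) ∧
    (∀ b : L.obj.neg, BiTop.negSet (X := L.obj.bptObj)
      ((adj.counit.app (Opposite.op L)).unop.hom.neg b) =
        {p : L.obj.bptObj.carrier | p.neg b}) := by
  have key (p : L.obj.bptObj.carrier) :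
      Biframe.Hom.comp (adj.counit.app (Opposite.op L)).unop.hom
        ((adj.unit.app L.obj.bptObj).toFun p) = p :=
    congrFun (congrArg BiTop.Hom.toFun
      (adj.right_triangle_components (Opposite.op L))) p
  refine ⟨fun a => Set.ext fun p => iff_of_eq ?_, fun b => Set.ext fun p => iff_of_eq ?_⟩
  · exact ((h _ p).1 _).symm.trans
      (congrArg (fun q : L.obj.bptObj.carrier => q.pos a) (key p))
  · exact ((h _ p).2 _).symm.trans
      (congrArg (fun q : L.obj.bptObj.carrier => q.neg b) (key p))

theorem dOmega_counit_of_unit (adj : dOmega.{u} ⊣ dpt.{u})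
    (h : ∀ (X : BiTop.{u}) (x : X.carrier),
      (∀ U : Opens X.P, ((adj.unit.app X).toFun x :
        DFrame.Hom X.dOmegaObj DFrame.two).pos U = (X.point x).pos U) ∧
      (∀ V : Opens X.N, ((adj.unit.app X).toFun x :
        DFrame.Hom X.dOmegaObj DFrame.two).neg V = (X.point x).neg V))
    (L : DFrm.{u}) :
    (∀ a : L.pos, BiTop.posSet (X := L.dptObj)
      ((adj.counit.app (Opposite.op L)).unop.pos a) =
        {p : L.dptObj.carrier | p.pos a}) ∧
    (∀ b : L.neg, BiTop.negSet (X := L.dptObj)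
      ((adj.counit.app (Opposite.op L)).unop.neg b) =
        {p : L.dptObj.carrier | p.neg b}) := by
  have key (p : L.dptObj.carrier) :
      DFrame.Hom.comp (adj.counit.app (Opposite.op L)).unop
        ((adj.unit.app L.dptObj).toFun p) = p :=
    congrFun (congrArg BiTop.Hom.toFun
      (adj.right_triangle_components (Opposite.op L))) p
  refine ⟨fun a => Set.ext fun p => iff_of_eq ?_, fun b => Set.ext fun p => iff_of_eq ?_⟩
  · exact ((h _ p).1 _).symm.trans
      (congrArg (fun q : L.dptObj.carrier => q.pos a) (key p))
  · exact ((h _ p).2 _).symm.trans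
      (congrArg (fun q : L.dptObj.carrier => q.neg b) (key p))

theorem mainTheorem3 :
    ∃ (bAdj : bOmega.{u} ⊣ bpt.{u}) (bfAdj : bOmegaFin.{u} ⊣ bptFin.{u})
      (dAdj : dOmega.{u} ⊣ dpt.{u}) (coref : finIncl.{u} ⊣ finFunctor.{u})
      (gdAdj : Gamma.{u} ⊣ Delta.{u}),
      -- the units of the three spatial adjunctions send a point to its neighbourhood maps
      (∀ (X : BiTop.{u}) (x : X.carrier),
        (∀ U : Opens X.P,
          ((bAdj.unit.app X).toFun x : Biframe.Hom X.bOmegaObj Biframe.two).pos U ↔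
            x ∈ BiTop.posSet U) ∧
        (∀ V : Opens X.N,
          ((bAdj.unit.app X).toFun x : Biframe.Hom X.bOmegaObj Biframe.two).neg V ↔
            x ∈ BiTop.negSet V)) ∧
      (∀ (X : BiTop.{u}) (x : X.carrier),
        (∀ U : Opens X.P,
          ((bfAdj.unit.app X).toFun x : Biframe.Hom X.bOmegaFinObj Biframe.two).pos U ↔
            x ∈ BiTop.posSet U) ∧
        (∀ V : Opens X.N,
          ((bfAdj.unit.app X).toFun x : Biframe.Hom X.bOmegaFinObj Biframe.two).neg V ↔
            x ∈ BiTop.negSet V)) ∧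
      (∀ (X : BiTop.{u}) (x : X.carrier),
        (∀ U : Opens X.P,
          ((dAdj.unit.app X).toFun x : DFrame.Hom X.dOmegaObj DFrame.two).pos U ↔
            x ∈ BiTop.posSet U) ∧
        (∀ V : Opens X.N,
          ((dAdj.unit.app X).toFun x : DFrame.Hom X.dOmegaObj DFrame.two).neg V ↔
            x ∈ BiTop.negSet V)) ∧
      -- their counits are the spatialization maps
      (∀ L : BiFrm.{u},
        (∀ a : L.pos, BiTop.posSet (X := L.bptObj)
          ((bAdj.counit.app (Opposite.op L)).unop.pos a) = {p : L.bptObj.carrier | p.pos a}) ∧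
        (∀ b : L.neg, BiTop.negSet (X := L.bptObj)
          ((bAdj.counit.app (Opposite.op L)).unop.neg b) = {p : L.bptObj.carrier | p.neg b})) ∧
      (∀ L : BiFrmFin.{u},
        (∀ a : L.obj.pos, BiTop.posSet (X := L.obj.bptObj)
          ((bfAdj.counit.app (Opposite.op L)).unop.hom.pos a) =
            {p : L.obj.bptObj.carrier | p.pos a}) ∧
        (∀ b : L.obj.neg, BiTop.negSet (X := L.obj.bptObj)
          ((bfAdj.counit.app (Opposite.op L)).unop.hom.neg b) =
            {p : L.obj.bptObj.carrier | p.neg b})) ∧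
      (∀ L : DFrm.{u},
        (∀ a : L.pos, BiTop.posSet (X := L.dptObj)
          ((dAdj.counit.app (Opposite.op L)).unop.pos a) = {p : L.dptObj.carrier | p.pos a}) ∧
        (∀ b : L.neg, BiTop.negSet (X := L.dptObj)
          ((dAdj.counit.app (Opposite.op L)).unop.neg b) = {p : L.dptObj.carrier | p.neg b})) ∧
      -- the unit and the counit of the coreflection are identities on both components, and the
      -- unit is an isomorphism
      (∀ L : BiFrmFin.{u}, IsIso (coref.unit.app L) ∧
        (∀ a : L.obj.pos, (coref.unit.app L).hom.pos a = a) ∧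
        (∀ b : L.obj.neg, (coref.unit.app L).hom.neg b = b)) ∧
      (∀ L : BiFrm.{u},
        (∀ a : L.pos, (coref.counit.app L).pos a = a) ∧
        (∀ b : L.neg, (coref.counit.app L).neg b = b)) ∧
      -- the unit of `Γ ⊣ Δ` is the pair of quotient maps (bijective where the syntactic maps are
      -- injective), and the counit is induced by the identities
      (∀ L : DFrm.{u},
        (∀ a : L.pos, (gdAdj.unit.app L).pos a = L.toGammaPos a) ∧
        (∀ b : L.neg, (gdAdj.unit.app L).neg b = L.toGammaNeg b) ∧
        (Function.Injective L.synPos → Function.Bijective L.toGammaPos) ∧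
        (Function.Injective L.synNeg → Function.Bijective L.toGammaNeg)) ∧
      (∀ L : BiFrmFin.{u},
        (∀ a : L.obj.pos, (gdAdj.counit.app L).hom.pos (L.obj.delta.toGammaPos a) = a) ∧
        (∀ b : L.obj.neg, (gdAdj.counit.app L).hom.neg (L.obj.delta.toGammaNeg b) = b)) ∧
      -- `Γ` takes values in finitary biframes, and `Δ ∘ bΩ = dΩ`
      (∀ L : DFrm.{u}, Biframe.IsFinitary L.gamma) ∧
      dOmega.{u} = bOmega ⋙ DeltaAll.op ∧
      -- `bΩ_fin = fin ∘ bΩ`, and `bΩ_fin ⊣ bpt` is the composite adjunction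
      (∃ h : bOmegaFin.{u} = bOmega ⋙ finFunctor.op,
        bfAdj = (bAdj.comp coref.op).ofNatIsoLeft (eqToIso h.symm)) ∧
      -- `dΩ = Δ ∘ fin ∘ bΩ`, `dpt = bpt ∘ Γ` (through the canonical bihomeomorphism), and
      -- `dΩ ⊣ dpt` is the composite adjunction
      (∃ (h : dOmega.{u} = (bOmega ⋙ finFunctor.op) ⋙ Delta.op)
        (e : Gamma.{u}.op ⋙ bptFin ≅ dpt.{u}),
        (∀ (L : DFrm.{u}) (p : Biframe.Hom L.gamma Biframe.two),
          (∀ a : L.pos, ((e.hom.app (Opposite.op L)).toFun p : DFrame.Hom L DFrame.two).pos a =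
            p.pos (L.toGammaPos a)) ∧
          (∀ b : L.neg, ((e.hom.app (Opposite.op L)).toFun p : DFrame.Hom L DFrame.two).neg b =
            p.neg (L.toGammaNeg b))) ∧
        dAdj = (((bAdj.comp coref.op).comp gdAdj.op).ofNatIsoLeft
          (eqToIso h.symm)).ofNatIsoRight e) := by
  -- The two clauses on composite adjunctions hold by `rfl`, because the second and third
  -- adjunctions are defined as those composites.
  exact ⟨bOmegaAdjunction, bOmegaFinAdjunction, dOmegaAdjunction, finAdjunction,
    gammaDeltaAdjunction, fun X x => ⟨fun U => Iff.rfl, fun V => Iff.rfl⟩,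
    fun X x => ⟨fun U => iff_of_eq ((bOmegaFinAdjunction_unit X x).1 U),
      fun V => iff_of_eq ((bOmegaFinAdjunction_unit X x).2 V)⟩,
    fun X x => ⟨fun U => iff_of_eq ((dOmegaAdjunction_unit X x).1 U),
      fun V => iff_of_eq ((dOmegaAdjunction_unit X x).2 V)⟩,
    fun L => ⟨fun a => rfl, fun b => rfl⟩, bOmegaFin_counit_of_unit _ bOmegaFinAdjunction_unit,
    dOmega_counit_of_unit _ dOmegaAdjunction_unit,
    fun L => ⟨isIso_finAdjunction_unit L, fun a => rfl, fun b => rfl⟩,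
    fun L => ⟨fun a => rfl, fun b => rfl⟩,
    fun L => ⟨fun a => rfl, fun b => rfl, L.toGammaPos_bijective, L.toGammaNeg_bijective⟩,
    fun L => ⟨L.obj.delta.gammaDesc_pos (DFrame.Hom.id L.obj.delta),
      L.obj.delta.gammaDesc_neg (DFrame.Hom.id L.obj.delta)⟩,
    fun L => L.gamma_isFinitary, dOmega_eq, ⟨bOmegaFin_eq, rfl⟩,
    dOmega_eq_fin, gammaBptIso, fun L p => ⟨fun a => rfl, fun b => rfl⟩, rfl⟩
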